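/- Let $\omega, C\in\mathbb{R}$ satisfy the periodic stability conditions: either $0<\omega<2$ and $|C|\le 1$, or $\omega=2$ and $|C|<1$. Put $a_{\pm1}=\tfrac12(2-\omega\mp\omega C)$, $b_0=\omega-1$ and $\eta(z)=z-b_0z^{-1}$. Let $(\alpha_j)_{j\ge0}$ and $(\beta_j)_{j\ge 0}$ be real weights (the outflow boundary scheme $u_0^{n+1}=\sum_j\alpha_ju_j^n+\sum_j\beta_ju_j^{n-1}$) with $\alpha_j=0$ for $j\ge N_\alpha$ and $\beta_j=0$ for $j\ge N_\beta$. Let $$E_{2J}=\begin{pmatrix}A_J&B_J\\ I_J&0\end{pmatrix}\in\mathbb{R}^{2J\times 2J},$$ where the first rows of $A_J$, $B_J$ are $(\alpha_0,\dots,\alpha_{J-1})$, $(\beta_0,\dots,\beta_{J-1})$, their last rows vanish, and the inner rows $i=1,\dots,J-2$ have the nonzero entries $(A_J)_{i,i-1}=a_{-1}$, $(A_J)_{i,i+1}=a_1$, $(B_J)_{i,i}=b_0$. Let $E^\times_{2J}$ be the matrix of the same form in which $A_J$ is replaced by the tridiagonal Toeplitz matrix with $a_{-1},0,a_1$ on the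 sub-, main and superdiagonal, and $B_J$ by $b_0I_J$. The asymptotic spectrum of a sequence of matrices $(M_J)_J$ is the set of limits of eigenvalues $w_k$ of $M_{J_k}$ with $J_k\to\infty$. **Theorem.** Let $z^\odot\ne0$ be an isolated point of the asymptotic spectrum of $E_{2J}$ that is created by the outflow boundary condition, i.e. does not belong to the asymptotic spectrum of $E_{2J}^\times$. Then there is $\varepsilon_0>0$ such that for all $0<\varepsilon<\varepsilon_0$ and all $J\ge J_0(\varepsilon)$ the number $m$ of eigenvalues of $E_{2J}$ in $B_\varepsilon(z^\odot)$, counted with algebraic multiplicity, is given as follows. 1. If $a_{-1}=0$, then $m$ is the order of the zero at $z^\odot$ of $$z\mapsto\frac{z^2-\alpha_0z-\beta_0}{z^2-(\omega-1)}=\frac{z^2-\alpha_0z-\beta_0}{(z-\sqrt{\omega-1})(z+\sqrt{\omega-1})}.$$ 2. If $a_{-1}\neq0$, then $m$ is the order of the zero at $z^\odot$ of $$F_\kappa(z)=z-\sum_{i=0}^{N_\alpha-1}\alpha_i\,\kappa(z)^i-z^{-1}\sum_{i=0}^{N_\beta-1}\beta_i\,\kappa(z)^i ,$$ where $\kappa$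 is the following solution of the characteristic equation $\eta(z)=a_{-1}\kappa^{-1}+a_1\kappa$: - if $a_1=0$, the only root $\kappa(z)=a_{-1}\eta(z)^{-1}$; - if $a_1\ne0$, a continuous root $\kappa$ on the closed ball $\overline{B_\varepsilon(z^\odot)}$ such that for some $\tilde z\in\partial B_\varepsilon(z^\odot)$ $$\lim_{J\to\infty}\frac{1}{\sqrt{a_{-1}a_1}}\,\frac{U_{J-1}\big(\tfrac{\eta(\tilde z)}{2\sqrt{a_{-1}a_1}}\big)}{U_{J}\big(\tfrac{\eta(\tilde z)}{2\sqrt{a_{-1}a_1}}\big)}=\frac{\kappa(\tilde z)}{a_{-1}},$$ with $U_J$ the Chebyshev polynomial of the second kind of degree $J$. Such a root exists. The assertion on $m$ is made for every such root, provided, in the case $|C|=1$ only, that $F_\kappa$ does not vanish identically near $z^\odot$. Moreover, in the last case ($a_{-1},a_1\neq0$, with the same proviso), let $\kappa_\pm$ be the two roots of the characteristic equation near $z^\odot$, with $\kappa_-=\kappa$ near $z^\odot$, and suppose that $F_{\kappa_+}(z^\odot)\ne0$. Then $m$ is the order of the pole at $z^\odot$ of the reflection coefficient $R_{\mathrm{out}}(z)=-F_{\kappa_+}(z)/F_{\kappa_-}(z)$.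 -/

import Mathlib

open Filter Topology

namespace TwoVelocityScheme

noncomputable section

/-- The coefficient `a_{-1} = (2 - ω + ω C) / 2` of the bulk scheme
`u_j^{n+1} = a_{-1} u_{j-1}^n + a_1 u_{j+1}^n + b_0 u_j^{n-1}`. -/
def aNeg (ω C : ℝ) : ℝ := (2 - ω + ω * C) / 2

/-- The coefficient `a_1 = (2 - ω - ω C) / 2` of the bulk scheme. -/
def aPos (ω C : ℝ) : ℝ := (2 - ω - ω * C) / 2

/-- The coefficient `b_0 = ω - 1` of the bulk scheme. -/
def bZero (ω : ℝ) : ℝ := ω - 1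

/-- The `L²` stability conditions of the bulk scheme with periodic boundary conditions. -/
def PeriodicStabilityConditions (ω C : ℝ) : Prop :=
  (0 < ω ∧ ω < 2 ∧ |C| ≤ 1) ∨ (ω = 2 ∧ |C| < 1)

/-- The block companion matrix with blocks `A`, `B` in the first row and `1`, `0` in the second. -/
def companion {J : ℕ} (A B : Matrix (Fin J) (Fin J) ℝ) :
    Matrix (Fin J ⊕ Fin J) (Fin J ⊕ Fin J) ℝ :=
  Matrix.fromBlocks A B 1 0

/-- The block `A_J`: outflow weights `α` in the first row, the bulk scheme in the inner rows, and
a vanishing last row (homogeneous inflow condition). -/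
def blockA (ω C : ℝ) (α : ℕ → ℝ) (J : ℕ) : Matrix (Fin J) (Fin J) ℝ :=
  Matrix.of fun i j =>
    if (i : ℕ) = 0 then α j
    else if (i : ℕ) + 1 = J then 0
    else if (j : ℕ) + 1 = i then aNeg ω C
    else if (j : ℕ) = i + 1 then aPos ω C
    else 0

/-- The block `B_J`: outflow weights `β` in the first row, `b_0` on the diagonal of the inner rows,
and a vanishing last row. -/
def blockB (ω : ℝ) (β : ℕ → ℝ) (J : ℕ) : Matrix (Fin J) (Fin J) ℝ :=
  Matrix.of fun i j =>
    if (i : ℕ) = 0 then β j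
    else if (i : ℕ) + 1 = J then 0
    else if j = i then bZero ω
    else 0

/-- The scheme matrix `E_{2J}`, acting on `(u_0^n, …, u_{J-1}^n, u_0^{n-1}, …, u_{J-1}^{n-1})`. -/
def schemeMatrix (ω C : ℝ) (α β : ℕ → ℝ) (J : ℕ) : Matrix (Fin J ⊕ Fin J) (Fin J ⊕ Fin J) ℝ :=
  companion (blockA ω C α J) (blockB ω β J)

/-- The tridiagonal Toeplitz matrix `A_J^×`. -/
def toeplitzA (ω C : ℝ) (J : ℕ) : Matrix (Fin J) (Fin J) ℝ :=
  Matrix.of fun i j =>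
    if (j : ℕ) + 1 = i then aNeg ω C
    else if (j : ℕ) = i + 1 then aPos ω C
    else 0

/-- The Toeplitz version `E_{2J}^×` of the scheme matrix, without boundary rows. -/
def toeplitzMatrix (ω C : ℝ) (J : ℕ) : Matrix (Fin J ⊕ Fin J) (Fin J ⊕ Fin J) ℝ :=
  companion (toeplitzA ω C J) (Matrix.diagonal fun _ => bZero ω)

/-- The complex eigenvalues of a real square matrix, repeated according to their algebraic
multiplicity. -/
def eigenvalues {n : Type*} [Fintype n] [DecidableEq n] (M : Matrix n n ℝ) : Multiset ℂ :=
  (M.map (algebraMap ℝ ℂ)).charpoly.roots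

open Classical in
/-- The number of eigenvalues of `M` in the open ball `B_ε(c)`, counted with algebraic
multiplicity. -/
def eigenvalueCount {n : Type*} [Fintype n] [DecidableEq n] (M : Matrix n n ℝ) (c : ℂ) (ε : ℝ) :
    ℕ :=
  (eigenvalues M).countP (fun w => w ∈ Metric.ball c ε)

/-- The asymptotic spectrum of a sequence of matrices: the set of all limits of eigenvalues
`w_k` of `M (J_k)` with `J_k → ∞`. -/
def asymptoticSpectrum (M : (J : ℕ) → Matrix (Fin J ⊕ Fin J) (Fin J ⊕ Fin J) ℝ) : Set ℂ :=
  {z | ∀ δ > 0, ∃ᶠ J in atTop, ∃ w ∈ eigenvalues (M J), dist w z < δ}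

/-- `c ≠ 0` is an isolated point of the asymptotic spectrum of `E_{2J}` which is created by the
outflow condition, i.e. which is not in the asymptotic spectrum of `E_{2J}^×` (and is not the
eigenvalue `0` created by the inflow condition). -/
def IsIsolatedOutflowPoint (ω C : ℝ) (α β : ℕ → ℝ) (c : ℂ) : Prop :=
  c ≠ 0 ∧ c ∉ asymptoticSpectrum (toeplitzMatrix ω C) ∧
    ∃ r > 0, Metric.ball c r ∩ asymptoticSpectrum (schemeMatrix ω C α β) = {c}

/-- `η(z) = z - b_0 z⁻¹`. -/
def eta (ω : ℝ) (z : ℂ) : ℂ := z - (bZero ω : ℂ) * z⁻¹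

/-- `κ` solves the bulk characteristic equation `η(z) = a_{-1} κ⁻¹ + a_1 κ`, understood as a
quadratic equation in `κ`. -/
def BulkCharEq (ω C : ℝ) (z κ : ℂ) : Prop :=
  eta ω z * κ = (aNeg ω C : ℂ) + (aPos ω C : ℂ) * κ ^ 2

/-- The boundary function
`z ↦ z - ∑_{i < Nα} α_i κ(z)^i - z⁻¹ ∑_{i < Nβ} β_i κ(z)^i`. -/
def boundaryFunction (Nα Nβ : ℕ) (α β : ℕ → ℝ) (κ : ℂ → ℂ) (z : ℂ) : ℂ :=
  z - ∑ i ∈ Finset.range Nα, (α i : ℂ) * κ z ^ i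
    - z⁻¹ * ∑ i ∈ Finset.range Nβ, (β i : ℂ) * κ z ^ i

/-- The principal square root of the (possibly negative) real number `a_{-1} a_1`. -/
def sqrtProd (ω C : ℝ) : ℂ := ((aNeg ω C * aPos ω C : ℝ) : ℂ) ^ (1 / 2 : ℂ)

/-- `(1/s) U_{J-1}(η(z)/(2s)) / U_J(η(z)/(2s))` with `s = √(a_{-1} a_1)` and `U_J` the Chebyshev
polynomial of the second kind of degree `J`. -/
def chebyshevRatio (ω C : ℝ) (z : ℂ) (J : ℕ) : ℂ :=
  1 / sqrtProd ω C *
    ((Polynomial.Chebyshev.U ℂ ((J : ℤ) - 1)).eval (eta ω z / (2 * sqrtProd ω C)) /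
      (Polynomial.Chebyshev.U ℂ (J : ℤ)).eval (eta ω z / (2 * sqrtProd ω C)))

/-- `κ` is a continuous branch, on the closed ball of centre `c` and radius `ε`, of solutions of the
bulk characteristic equation, and at some point `w` of the boundary circle the Chebyshev ratio
converges to `κ(w) / a_{-1}` as `J → ∞`. -/
def IsSelectedRoot (ω C : ℝ) (c : ℂ) (ε : ℝ) (κ : ℂ → ℂ) : Prop :=
  ContinuousOn κ (Metric.closedBall c ε) ∧
    (∀ z ∈ Metric.closedBall c ε, BulkCharEq ω C z (κ z)) ∧
    ∃ w ∈ Metric.sphere c ε,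
      Tendsto (fun J : ℕ => chebyshevRatio ω C w J) atTop (𝓝 (κ w / (aNeg ω C : ℂ)))

/-- `κm` and `κp` are, near `c`, the two roots (with multiplicity) of the bulk characteristic
equation `a_1 κ² - η(z) κ + a_{-1} = 0`. -/
def AreTheTwoRootsNear (ω C : ℝ) (c : ℂ) (κm κp : ℂ → ℂ) : Prop :=
  ∀ᶠ z in 𝓝 c, (aPos ω C : ℂ) * (κm z + κp z) = eta ω z ∧
    (aPos ω C : ℂ) * (κm z * κp z) = (aNeg ω C : ℂ)

/-- The reflection coefficient of the outflow boundary, i.e. the ratio `A_- / A_+` of the amplitudes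
of the solution `A_- κm^j + A_+ κp^j` of the bulk equation which satisfies the boundary scheme. -/
def reflectionCoefficient (Nα Nβ : ℕ) (α β : ℕ → ℝ) (κm κp : ℂ → ℂ) (z : ℂ) : ℂ :=
  -(boundaryFunction Nα Nβ α β κp z / boundaryFunction Nα Nβ α β κm z)

/-- The function `f` is analytic at `c` and has there a zero of (finite) order `m`. -/
def HasZeroOfOrder (f : ℂ → ℂ) (c : ℂ) (m : ℕ) : Prop :=
  AnalyticAt ℂ f c ∧ analyticOrderAt f c = (m : ℕ∞)

/-- The function `R` is meromorphic at `c` and has there a pole of order `m`. -/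
def HasPoleOfOrder (R : ℂ → ℂ) (c : ℂ) (m : ℕ) : Prop :=
  MeromorphicAt R c ∧ meromorphicOrderAt R c = ((-(m : ℤ) : ℤ) : WithTop ℤ)

end

end TwoVelocityScheme

/-!
The number of eigenvalues near an outflow point is found by factoring the characteristic polynomial
of the scheme matrix and applying Hurwitz's theorem to the factor which has zeros.

For `z ≠ 0` the `2J`-dimensional characteristic polynomial is `z ^ J` times a `J`-dimensional
determinant. Its last row is trivial and its zeroth row carries the boundary scheme, while the rest
is tridiagonal. Expansion along these rows (`eval_charpoly_schemeMatrix`) gives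
`z ^ (J + 1) * ∑ j < J - 1, g_j * a_{-1} ^ j * D_{J-2-j}`, where `g_j` are the coefficients of the
boundary scheme and `D_n` is the determinant of the tridiagonal Toeplitz matrix with
`-a_{-1}, η(z), -a_1`, which is also the essential factor for the Toeplitz version of the scheme.

If `a_{-1} a_1 = 0`, then `D_n = η ^ n`, and `η` does not vanish at a point outside the asymptotic
spectrum of the Toeplitz matrices. The sum is then a power of `η` times the function whose zero is
counted, and nothing has to converge.

If `a_{-1} a_1 ≠ 0`, then `D_n` is a Chebyshev polynomial in `η`. Its zeros accumulate wherever the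
two bulk roots have the same modulus (`mem_asymptoticSpectrum_toeplitzMatrix`), so that at the point
in question the roots satisfy `‖κm‖ < ‖κp‖` and are analytic nearby. By `sum_boundary_of_roots` the
characteristic polynomial is a function without zeros times
`F_κm - (κm / κp) ^ (J - 1) * F_κp`, which converges uniformly to `F_κm`, and Hurwitz's theorem
(`eventually_countP_roots_eq_order`) counts its zeros. The Chebyshev ratio converges to
`κm / a_{-1}` (`tendsto_chebyshevRatio`), so the selected root is `κm`, first at one point and then,
by connectedness, on the whole ball.

It remains to exclude that `F_κm` vanishes identically when `|C| < 1`
(`not_eventually_boundaryFunction_eq_zero`): otherwise `κm` would be the quotient of two polynomials,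
and the discriminant of the bulk characteristic equation would be a square, although it has a simple
zero.
-/

namespace TwoVelocityScheme

open Polynomial Metric

/-! ### Counting the roots of polynomials by the argument principle -/

theorem circleIntegral_multiset_sum_inv_sub
    {c : ℂ} {ε : ℝ} (hε : 0 < ε) [DecidablePred (· ∈ ball c ε)] (s : Multiset ℂ)
    (hs : ∀ w ∈ s, w ∉ sphere c ε) :
    CircleIntegrable (fun z => (s.map fun w => 1 / (z - w)).sum) c ε ∧
      (∮ z in C(c, ε), (s.map fun w => 1 / (z - w)).sum) =
        2 * Real.pi * Complex.I * (s.countP (· ∈ ball c ε) : ℂ) := by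
  induction s using Multiset.induction_on with
  | empty =>
    simp only [Multiset.map_zero, Multiset.sum_zero, Multiset.countP_zero, Nat.cast_zero, mul_zero]
    exact ⟨circleIntegrable_const 0 c ε, by simp [circleIntegral]⟩
  | cons w s ih =>
    obtain ⟨hi, hv⟩ := ih fun v hv => hs v (Multiset.mem_cons_of_mem hv)
    have hw : w ∉ sphere c ε := hs w (Multiset.mem_cons_self w s)
    have hwi : CircleIntegrable (fun z => (z - w)⁻¹) c ε := by
      rw [circleIntegrable_sub_inv_iff, abs_of_pos hε]; exact Or.inr hw
    simp only [Multiset.map_cons, Multiset.sum_cons, one_div] at hi hv ⊢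
    refine ⟨hwi.add hi, ?_⟩
    rw [circleIntegral.integral_add hwi hi, hv]
    by_cases hb : w ∈ ball c ε
    · rw [circleIntegral.integral_sub_inv_of_mem_ball hb, Multiset.countP_cons_of_pos _ hb]
      push_cast; ring
    · rw [Multiset.countP_cons_of_neg _ hb]
      have hne : ∀ z ∈ closedBall c ε, z - w ≠ 0 := by
        intro z hz h
        rw [sub_eq_zero] at h
        subst h
        rcases (mem_closedBall.1 hz).lt_or_eq with h | h
        · exact hb h
        · exact hw h
      have : (∮ z in C(c, ε), (z - w)⁻¹) = 0 :=
        Complex.circleIntegral_eq_zero_of_differentiable_on_off_countable hε.le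
          Set.countable_empty
          (ContinuousOn.inv₀ (by fun_prop) hne)
          fun z hz => DifferentiableAt.inv (by fun_prop) (hne z (ball_subset_closedBall hz.1))
      rw [this, zero_add]

open Classical in
theorem circleIntegral_logDeriv_polynomial {c : ℂ} {ε : ℝ} (hε : 0 < ε) {P : ℂ[X]}
    (hP : ∀ z ∈ sphere c ε, P.eval z ≠ 0) :
    (∮ z in C(c, ε), logDeriv (fun x => P.eval x) z) =
      2 * Real.pi * Complex.I * (P.roots.countP (· ∈ ball c ε) : ℂ) := by
  rw [← (circleIntegral_multiset_sum_inv_sub hε P.roots fun w hw hws =>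
    hP w hws (Polynomial.isRoot_of_mem_roots hw)).2]
  refine circleIntegral.integral_congr hε.le fun z hz => ?_
  simp only [logDeriv_apply, Polynomial.deriv]
  exact (IsAlgClosed.splits P).eval_derivative_div_eval_of_ne_zero (hP z hz)

theorem circleIntegral_logDeriv_eq_zero {c : ℂ} {ε r : ℝ} (hε : 0 < ε) (hr : ε < r)
    {u : ℂ → ℂ} (hu : DifferentiableOn ℂ u (ball c r)) (h0 : ∀ z ∈ ball c r, u z ≠ 0) :
    (∮ z in C(c, ε), logDeriv u z) = 0 := by
  have hd : DifferentiableOn ℂ (logDeriv u) (ball c r) := (hu.deriv isOpen_ball).div hu h0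
  exact Complex.circleIntegral_eq_zero_of_differentiable_on_off_countable hε.le
    Set.countable_empty (hd.continuousOn.mono (closedBall_subset_ball hr))
    fun z hz => hd.differentiableAt (isOpen_ball.mem_nhds
      (closedBall_subset_ball hr (ball_subset_closedBall hz.1)))

/-- The argument principle for a function whose only zero in the ball is its centre. -/
theorem circleIntegral_logDeriv_of_order {c : ℂ} {ε r : ℝ} (hε : 0 < ε) (hr : ε < r)
    {f : ℂ → ℂ} (hf : DifferentiableOn ℂ f (ball c r)) (h0 : ∀ z ∈ ball c r, z ≠ c → f z ≠ 0)
    {m : ℕ} (hm : analyticOrderAt f c = m) :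
    (∮ z in C(c, ε), logDeriv f z) = 2 * Real.pi * Complex.I * (m : ℂ) := by
  have hcr : c ∈ ball c r := mem_ball_self (hε.trans hr)
  have hfa : AnalyticAt ℂ f c := hf.analyticAt (isOpen_ball.mem_nhds hcr)
  obtain ⟨g, hga, hgc, hfg⟩ := hfa.analyticOrderAt_eq_natCast.1 hm
  set k : ℂ → ℂ := Function.update (fun z => logDeriv f z - m * (z - c)⁻¹) c (logDeriv g c) with hk
  have hk_ne : ∀ z, z ≠ c → k z = logDeriv f z - m * (z - c)⁻¹ := fun z hz => by
    rw [hk, Function.update_of_ne hz]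
  -- Near `c` the regular part of the logarithmic derivative of `f` is that of the cofactor `g`.
  have hkg : k =ᶠ[𝓝 c] logDeriv g := by
    filter_upwards [hfg.eventually_nhds, hga.eventually_analyticAt,
      hga.continuousAt.eventually_ne hgc] with z hz hgz hgz0
    rcases eq_or_ne z c with rfl | hzc
    · simp [hk]
    have hz' : f =ᶠ[𝓝 z] fun z => (z - c) ^ m * g z := by simpa [smul_eq_mul] using! hz
    have hzc' : z - c ≠ 0 := sub_ne_zero.2 hzc
    rw [hk_ne z hzc, logDeriv_apply, hz'.deriv_eq, hz'.eq_of_nhds, ← logDeriv_apply,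
      logDeriv_mul (f := fun x => (x - c) ^ m) z (pow_ne_zero _ hzc') hgz0 (by fun_prop)
        hgz.differentiableAt, logDeriv_fun_pow (f := fun x => x - c) (by fun_prop)]
    simp [logDeriv_apply]
  have hkd : DifferentiableOn ℂ k (ball c r) := by
    intro z hz
    rcases eq_or_ne z c with rfl | hzc
    · refine (DifferentiableAt.congr_of_eventuallyEq ?_ hkg).differentiableWithinAt
      exact (hga.deriv.div hga hgc).differentiableAt
    · have h1 : (fun z => logDeriv f z - m * (z - c)⁻¹) =ᶠ[𝓝 z] k := by
        filter_upwards [isOpen_ne.mem_nhds hzc] with w hw using (hk_ne w hw).symm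
      refine (DifferentiableAt.congr_of_eventuallyEq ?_ h1.symm).differentiableWithinAt
      have hfz : AnalyticAt ℂ f z := hf.analyticAt (isOpen_ball.mem_nhds hz)
      have : DifferentiableAt ℂ (logDeriv f) z :=
        (hfz.deriv.div hfz (h0 z hz hzc)).differentiableAt
      exact this.sub ((differentiableAt_const _).mul
        (DifferentiableAt.inv (by fun_prop) (sub_ne_zero.2 hzc)))
  have hk0 : (∮ z in C(c, ε), k z) = 0 :=
    Complex.circleIntegral_eq_zero_of_differentiable_on_off_countable hε.le
      Set.countable_empty (hkd.continuousOn.mono (closedBall_subset_ball hr))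
      fun z hz => hkd.differentiableAt (isOpen_ball.mem_nhds
        (closedBall_subset_ball hr (ball_subset_closedBall hz.1)))
  have hsub : sphere c ε ⊆ ball c r := sphere_subset_closedBall.trans (closedBall_subset_ball hr)
  have hsc : ∀ z ∈ sphere c ε, z ≠ c := fun z hz => ne_of_mem_sphere hz hε.ne'
  have hki : CircleIntegrable k c ε := (hkd.continuousOn.mono hsub).circleIntegrable hε.le
  have hi : CircleIntegrable (fun z => (m : ℂ) * (z - c)⁻¹) c ε :=
    (continuousOn_const.mul (ContinuousOn.inv₀ (by fun_prop)
      fun z hz => sub_ne_zero.2 (hsc z hz))).circleIntegrable hε.le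
  rw [circleIntegral.integral_congr (g := fun z => k z + m * (z - c)⁻¹) hε.le
    fun z hz => by simp [hk_ne z (hsc z hz)],
    circleIntegral.integral_add hki hi, hk0, circleIntegral.integral_const_mul,
    circleIntegral.integral_sub_center_inv c hε.ne']
  ring

open Classical in
/-- A form of Hurwitz's theorem: if the polynomials `P J` are, up to factors `u J` without zeros,
functions converging locally uniformly to `f`, and `f` vanishes in the ball at most at the centre,
with order `m`, then `P J` has eventually `m` roots in every smaller concentric ball. -/
theorem eventually_countP_roots_eq_order {c : ℂ} {ε r : ℝ} (hε : 0 < ε) (hr : ε < r)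
    {P : ℕ → ℂ[X]} {u h : ℕ → ℂ → ℂ} {f : ℂ → ℂ} {m : ℕ}
    (hP : ∀ᶠ J in atTop, ∀ z ∈ ball c r, (P J).eval z = u J z * h J z)
    (hu : ∀ᶠ J in atTop, DifferentiableOn ℂ (u J) (ball c r))
    (hu0 : ∀ᶠ J in atTop, ∀ z ∈ ball c r, u J z ≠ 0)
    (hh : ∀ᶠ J in atTop, DifferentiableOn ℂ (h J) (ball c r))
    (hlim : TendstoLocallyUniformlyOn h f atTop (ball c r))
    (h0 : ∀ z ∈ ball c r, z ≠ c → f z ≠ 0) (hm : analyticOrderAt f c = m) :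
    ∀ᶠ J in atTop, (P J).roots.countP (· ∈ ball c ε) = m := by
  have hsub : sphere c ε ⊆ ball c r := sphere_subset_closedBall.trans (closedBall_subset_ball hr)
  have hf : DifferentiableOn ℂ f (ball c r) := hlim.differentiableOn hh isOpen_ball
  have hf0 : ∀ z ∈ sphere c ε, f z ≠ 0 := fun z hz =>
    h0 z (hsub hz) (ne_of_mem_sphere hz hε.ne')
  have hS : IsCompact (sphere c ε) := isCompact_sphere c ε
  have hlimS : TendstoLocallyUniformlyOn h f atTop (sphere c ε) := hlim.mono hsub
  -- The functions `h J` have no zeros on the circle once they are close enough to `f` there.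
  have hh0 : ∀ᶠ J in atTop, ∀ z ∈ sphere c ε, h J z ≠ 0 := by
    obtain ⟨δ, hδ, hδf⟩ : ∃ δ > 0, ∀ z ∈ sphere c ε, δ ≤ ‖f z‖ := by
      obtain ⟨w, hw, hmin⟩ := hS.exists_isMinOn (NormedSpace.sphere_nonempty.2 hε.le)
        (hf.continuousOn.mono hsub).norm
      exact ⟨‖f w‖, norm_pos_iff.2 (hf0 w hw), fun z hz => hmin hz⟩
    have hlimU := (tendstoLocallyUniformlyOn_iff_tendstoUniformlyOn_of_compact hS).1 hlimS
    filter_upwards [Metric.tendstoUniformlyOn_iff.1 hlimU δ hδ] with J hJ z hz hz0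
    have := hJ z hz
    rw [hz0, dist_zero_right] at this
    exact absurd this (hδf z hz).not_gt
  have hlog : TendstoUniformlyOn (fun J => logDeriv (h J)) (logDeriv f) atTop (sphere c ε) := by
    rw [← tendstoLocallyUniformlyOn_iff_tendstoUniformlyOn_of_compact hS]
    exact ((hlim.deriv hh isOpen_ball).mono hsub).div₀ hlimS
      ((hf.deriv isOpen_ball).continuousOn.mono hsub) (hf.continuousOn.mono hsub) hf0
  have hcont : ∀ᶠ J in atTop, ContinuousOn (logDeriv (h J)) (sphere c ε) := by
    filter_upwards [hh, hh0] with J hJ hJ0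
    exact ((hJ.deriv isOpen_ball).continuousOn.mono hsub).div (hJ.continuousOn.mono hsub) hJ0
  have hint := hlog.tendsto_circleIntegral_of_continuousOn hε.le hcont
  rw [circleIntegral_logDeriv_of_order hε hr hf h0 hm] at hint
  have hcount : ∀ᶠ J in atTop, (∮ z in C(c, ε), logDeriv (h J) z) =
      2 * Real.pi * Complex.I * ((P J).roots.countP (· ∈ ball c ε) : ℂ) := by
    filter_upwards [hP, hu, hu0, hh, hh0, hcont] with J hPJ huJ hu0J hhJ hh0J hcJ
    rw [← circleIntegral_logDeriv_polynomial hε fun z hz => by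
      rw [hPJ z (hsub hz)]; exact mul_ne_zero (hu0J z (hsub hz)) (hh0J z hz)]
    have hui : CircleIntegrable (logDeriv (u J)) c ε :=
      ((((huJ.deriv isOpen_ball).div huJ hu0J).continuousOn).mono hsub).circleIntegrable hε.le
    rw [circleIntegral.integral_congr (f := logDeriv fun x => (P J).eval x)
      (g := fun z => logDeriv (u J) z + logDeriv (h J) z) hε.le,
      circleIntegral.integral_add hui (hcJ.circleIntegrable hε.le),
      circleIntegral_logDeriv_eq_zero hε hr huJ hu0J, zero_add]
    intro z hz
    have hzU : ball c r ∈ 𝓝 z := isOpen_ball.mem_nhds (hsub hz)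
    have he : (fun x => (P J).eval x) =ᶠ[𝓝 z] fun x => u J x * h J x := by
      filter_upwards [hzU] with x hx using hPJ x hx
    change logDeriv (fun x => (P J).eval x) z = logDeriv (u J) z + logDeriv (h J) z
    rw [logDeriv_apply, he.deriv_eq, he.eq_of_nhds, ← logDeriv_apply,
      logDeriv_mul z (hu0J z (hsub hz)) (hh0J z hz) (huJ.differentiableAt hzU)
        (hhJ.differentiableAt hzU)]
  have hpi : (2 * Real.pi * Complex.I : ℂ) ≠ 0 := Complex.two_pi_I_ne_zero
  have hlimN : Tendsto (fun J => ((P J).roots.countP (· ∈ ball c ε) : ℂ)) atTop (𝓝 (m : ℂ)) := by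
    have := (hint.congr' hcount).const_mul (2 * Real.pi * Complex.I : ℂ)⁻¹
    simpa only [inv_mul_cancel_left₀ hpi] using this
  -- A convergent sequence of natural numbers is eventually constant.
  filter_upwards [Metric.tendsto_nhds.1 hlimN 1 one_pos] with J hJ
  rw [dist_eq_norm] at hJ
  have h1 : ‖(((((P J).roots.countP (· ∈ ball c ε) : ℕ) : ℤ) - (m : ℤ) : ℤ) : ℂ)‖ < 1 := by
    push_cast; exact hJ
  rw [Complex.norm_intCast] at h1
  have h2 : |((((P J).roots.countP (· ∈ ball c ε) : ℕ) : ℤ) - (m : ℤ) : ℤ)| < 1 := by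
    exact_mod_cast h1
  have := Int.abs_lt_one_iff.1 h2
  omega

/-! ### Tridiagonal determinants and characteristic polynomials -/

/-- The `(i, j)` entry of the tridiagonal Toeplitz matrix with `l`, `d`, `u` on the sub-, main and
superdiagonal. -/
def tridiagEntry {R : Type*} [Zero R] (l d u : R) (i j : ℕ) : R :=
  if j + 1 = i then l else if j = i then d else if j = i + 1 then u else 0

/-- The determinant of the tridiagonal Toeplitz matrix of size `n`. -/
def tridiagDet {R : Type*} [CommRing R] (l d u : R) (n : ℕ) : R :=
  (Matrix.of fun i j : Fin n => tridiagEntry l d u i j).det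

section Determinants

variable {R : Type*} [CommRing R] (l d u : R)

theorem tridiagEntry_succ_succ (i j : ℕ) :
    tridiagEntry l d u (i + 1) (j + 1) = tridiagEntry l d u i j := by
  simp [tridiagEntry]

/-- Deleting the zeroth row and the `j`-th column of a tridiagonal matrix leaves a block triangular
matrix: an upper triangular block of size `j` with diagonal `l`, followed by a tridiagonal block. -/
theorem det_tridiag_minor (n : ℕ) (j : Fin (n + 1)) :
    (Matrix.of fun i k : Fin n => tridiagEntry l d u (i + 1) (j.succAbove k)).det =
      l ^ (j : ℕ) * tridiagDet l d u (n - j) := by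
  induction n with
  | zero =>
    obtain rfl : j = 0 := Fin.fin_one_eq_zero j
    simp [tridiagDet]
  | succ n ih =>
    cases j using Fin.cases with
    | zero =>
      simp only [Fin.succAbove_zero, Fin.val_succ, tridiagEntry_succ_succ, Fin.val_zero, pow_zero,
        one_mul, Nat.sub_zero, tridiagDet]
      rfl
    | succ j =>
      rw [Matrix.det_succ_column_zero, Finset.sum_eq_single 0]
      · have h := ih j
        have hm : (Matrix.of fun i k : Fin (n + 1) =>
            tridiagEntry l d u (i + 1) (j.succ.succAbove k)).submatrix
              (Fin.succAbove 0) Fin.succ =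
            Matrix.of fun i k : Fin n => tridiagEntry l d u (i + 1) (j.succAbove k) := by
          ext i k
          simp [tridiagEntry_succ_succ]
        rw [hm, h]
        simp [tridiagEntry, pow_succ']
        ring
      · intro i _ hi
        have : (i : ℕ) ≠ 0 := fun h => hi (Fin.ext h)
        simp [tridiagEntry, this.symm]
      · simp

/-- The determinant of a tridiagonal Toeplitz matrix whose zeroth row is replaced by `g`. -/
theorem det_row_tridiag (g : ℕ → R) (n : ℕ) :
    (Matrix.of fun i j : Fin (n + 1) =>
        if (i : ℕ) = 0 then g j else tridiagEntry l d u i j).det =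
      ∑ j ∈ Finset.range (n + 1), (-1) ^ j * g j * (l ^ j * tridiagDet l d u (n - j)) := by
  rw [Matrix.det_succ_row_zero, Finset.sum_range]
  refine Finset.sum_congr rfl fun j _ => ?_
  rw [← det_tridiag_minor]
  simp [Matrix.submatrix]

theorem tridiagDet_zero : tridiagDet l d u 0 = 1 := by simp [tridiagDet]

theorem tridiagDet_one : tridiagDet l d u 1 = d := by simp [tridiagDet, tridiagEntry]

theorem tridiagDet_add_two (n : ℕ) :
    tridiagDet l d u (n + 2) = d * tridiagDet l d u (n + 1) - l * u * tridiagDet l d u n := by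
  have h := det_row_tridiag l d u (fun j => tridiagEntry l d u 0 j) (n + 1)
  have hm : (Matrix.of fun i j : Fin (n + 1 + 1) =>
        if (i : ℕ) = 0 then tridiagEntry l d u 0 j else tridiagEntry l d u i j) =
      Matrix.of fun i j : Fin (n + 2) => tridiagEntry l d u i j := by
    ext i j
    by_cases hi : (i : ℕ) = 0
    · simp [hi]
    · rw [Matrix.of_apply, Matrix.of_apply, if_neg hi]
  rw [hm, Finset.sum_range_succ', Finset.sum_range_succ', Finset.sum_eq_zero] at h
  · rw [tridiagDet, h]
    simp [tridiagEntry]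
    ring
  · intro j _
    simp [tridiagEntry]

theorem tridiagDet_of_mul_eq_zero (h : l * u = 0) (n : ℕ) : tridiagDet l d u n = d ^ n := by
  induction n using Nat.twoStepInduction with
  | zero => simp [tridiagDet_zero]
  | one => simp [tridiagDet_one]
  | more n _ ih => rw [tridiagDet_add_two, h, ih]; ring

/-- The solution of the recurrence in terms of the roots `p`, `q` of `X ^ 2 - d * X + l * u`. -/
theorem tridiagDet_mul_sub {p q : R} (hs : p + q = d) (hp : p * q = l * u) (n : ℕ) :
    tridiagDet l d u n * (p - q) = p ^ (n + 1) - q ^ (n + 1) := by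
  induction n using Nat.twoStepInduction with
  | zero => simp [tridiagDet_zero]
  | one => rw [tridiagDet_one, ← hs]; ring
  | more n ih₁ ih₂ =>
    rw [tridiagDet_add_two, sub_mul, mul_assoc, ih₂, mul_assoc (l * u), ih₁, ← hs, ← hp]
    ring

theorem det_last_row {n : ℕ} (M : Matrix (Fin (n + 1)) (Fin (n + 1)) R) (z : R)
    (h : ∀ j, M (Fin.last n) j = if j = Fin.last n then z else 0) :
    M.det = z * (M.submatrix Fin.castSucc Fin.castSucc).det := by
  rw [Matrix.det_succ_row M (Fin.last n), Finset.sum_eq_single (Fin.last n)]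
  · rw [h, Fin.succAbove_last]
    simp [← two_mul]
  · intro j _ hj
    rw [h, if_neg hj]
    simp
  · simp

end Determinants

theorem eval_charpoly_companion {J : ℕ} (A B : Matrix (Fin J) (Fin J) ℝ) {z : ℂ} (hz : z ≠ 0) :
    ((companion A B).map (algebraMap ℝ ℂ)).charpoly.eval z =
      z ^ J * (Matrix.scalar (Fin J) z - A.map (algebraMap ℝ ℂ)
        - z⁻¹ • B.map (algebraMap ℝ ℂ)).det := by
  rw [Matrix.eval_charpoly]
  set A' := A.map (algebraMap ℝ ℂ)
  set B' := B.map (algebraMap ℝ ℂ)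
  have h1 : Matrix.scalar (Fin J ⊕ Fin J) z - (companion A B).map (algebraMap ℝ ℂ) =
      Matrix.fromBlocks (Matrix.scalar (Fin J) z - A') (-B') (-1) (Matrix.scalar (Fin J) z) := by
    ext i j
    rcases i with i | i <;> rcases j with j | j <;>
      simp [companion, A', B', Matrix.diagonal_apply, Matrix.one_apply]
    all_goals split_ifs <;> simp
  -- A column operation eliminates the lower left block.
  have h2 : Matrix.fromBlocks (Matrix.scalar (Fin J) z - A') (-B') (-1) (Matrix.scalar (Fin J) z) *
      Matrix.fromBlocks 1 0 (z⁻¹ • 1) 1 =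
      Matrix.fromBlocks (Matrix.scalar (Fin J) z - A' - z⁻¹ • B') (-B') 0
        (Matrix.scalar (Fin J) z) := by
    rw [Matrix.fromBlocks_multiply]
    congr 1
    · simp [sub_eq_add_neg]
    · simp
    · ext i j
      simp only [Matrix.mul_one, Matrix.neg_apply, Matrix.one_apply, Matrix.add_apply, neg_mul,
        Matrix.scalar_apply, Matrix.mul_smul, Matrix.smul_apply, Matrix.diagonal_apply, one_mul,
        smul_eq_mul, Matrix.zero_apply]
      split_ifs <;> simp [hz]
    · simp
  have h3 := congrArg Matrix.det h2
  rw [Matrix.det_mul, Matrix.det_fromBlocks_zero₁₂, Matrix.det_fromBlocks_zero₂₁] at h3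
  rw [h1]
  simpa [mul_comm] using h3

/-- The determinant `D_n(z)` of the tridiagonal Toeplitz matrix with `-a_{-1}`, `η(z)`, `-a_1` on
its diagonals. -/
noncomputable def bulkDet (ω C : ℝ) (z : ℂ) (n : ℕ) : ℂ :=
  tridiagDet (-(aNeg ω C : ℂ)) (eta ω z) (-(aPos ω C : ℂ)) n

theorem eval_charpoly_toeplitzMatrix (ω C : ℝ) (J : ℕ) {z : ℂ} (hz : z ≠ 0) :
    ((toeplitzMatrix ω C J).map (algebraMap ℝ ℂ)).charpoly.eval z = z ^ J * bulkDet ω C z J := by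
  rw [toeplitzMatrix, eval_charpoly_companion _ _ hz, bulkDet, tridiagDet]
  congr 2
  ext i j
  rcases lt_trichotomy (i : ℕ) j with h | h | h
  · have : i ≠ j := fun e => by simp [e] at h
    have h3 : ¬ (j : ℕ) + 1 = i := by omega
    have h4 : ¬ (j : ℕ) = i := by omega
    simp [toeplitzA, tridiagEntry, this, h3, h4]
    split_ifs <;> simp
  · obtain rfl : i = j := Fin.ext h
    simp [toeplitzA, tridiagEntry, eta, mul_comm]
  · have : i ≠ j := fun e => by simp [e] at h
    have h3 : ¬ (j : ℕ) = i + 1 := by omega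
    have h4 : ¬ (j : ℕ) = i := by omega
    simp [toeplitzA, tridiagEntry, this, h3, h4]
    split_ifs <;> simp

/-- The coefficient of `u_j` in the boundary scheme, with all terms on one side and divided by
`z ^ n`, for solutions proportional to `z ^ n` in time step `n`. -/
noncomputable def boundaryCoeff (α β : ℕ → ℝ) (z : ℂ) (j : ℕ) : ℂ :=
  (if j = 0 then z else 0) - α j - z⁻¹ * β j

/-- Only the diagonal entry of the last row survives, by the vanishing inflow condition; the rest is
a tridiagonal matrix whose zeroth row carries the boundary scheme. -/
theorem eval_charpoly_schemeMatrix (ω C : ℝ) (α β : ℕ → ℝ) (n : ℕ) {z : ℂ} (hz : z ≠ 0) :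
    ((schemeMatrix ω C α β (n + 2)).map (algebraMap ℝ ℂ)).charpoly.eval z =
      z ^ (n + 3) * ∑ j ∈ Finset.range (n + 1),
        boundaryCoeff α β z j * ((aNeg ω C : ℂ) ^ j * bulkDet ω C z (n - j)) := by
  rw [schemeMatrix, eval_charpoly_companion _ _ hz, det_last_row _ z]
  · have hm : (Matrix.scalar (Fin (n + 2)) z - (blockA ω C α (n + 2)).map (algebraMap ℝ ℂ) -
        z⁻¹ • (blockB ω β (n + 2)).map (algebraMap ℝ ℂ)).submatrix Fin.castSucc Fin.castSucc =
        Matrix.of fun i j : Fin (n + 1) => if (i : ℕ) = 0 then boundaryCoeff α β z j else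
          tridiagEntry (-(aNeg ω C : ℂ)) (eta ω z) (-(aPos ω C : ℂ)) i j := by
      ext i j
      have hi : (i : ℕ) ≠ n + 1 := by omega
      by_cases hi0 : (i : ℕ) = 0
      · have : i = 0 := Fin.ext hi0
        subst this
        rcases eq_or_ne j 0 with rfl | hj
        · simp [blockA, blockB, boundaryCoeff]
        · have hj' : (Fin.castSucc 0 : Fin (n + 2)) ≠ j.castSucc := fun h =>
            hj (Fin.castSucc_injective _ h).symm
          rw [Matrix.submatrix_apply, Matrix.sub_apply, Matrix.sub_apply, Matrix.scalar_apply,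
            Matrix.diagonal_apply_ne _ hj']
          simp [blockA, blockB, boundaryCoeff, hj]
      · rcases lt_trichotomy (i : ℕ) j with h | h | h
        · have : i ≠ j := fun e => by simp [e] at h
          have h3 : ¬ (j : ℕ) + 1 = i := by omega
          have h4 : ¬ (j : ℕ) = i := by omega
          have hi0' : i ≠ 0 := fun h => hi0 (by simp [h])
          simp [blockA, blockB, tridiagEntry, this, this.symm, h3, h4, hi, hi0']
          split_ifs <;> simp
        · obtain rfl : i = j := Fin.ext h
          have hi0' : i ≠ 0 := fun h => hi0 (by simp [h])
          simp [blockA, blockB, tridiagEntry, eta, mul_comm, hi, hi0']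
        · have : i ≠ j := fun e => by simp [e] at h
          have h3 : ¬ (j : ℕ) = i + 1 := by omega
          have h4 : ¬ (j : ℕ) = i := by omega
          have hi0' : i ≠ 0 := fun h => hi0 (by simp [h])
          simp [blockA, blockB, tridiagEntry, this, this.symm, h3, h4, hi, hi0']
          split_ifs <;> simp
    rw [hm, det_row_tridiag, ← mul_assoc, ← pow_succ]
    congr 1
    refine Finset.sum_congr rfl fun j _ => ?_
    rw [neg_pow, bulkDet]
    have : ((-1 : ℂ) ^ j) * (-1) ^ j = 1 := by rw [← mul_pow]; simp
    linear_combination (boundaryCoeff α β z j * ((aNeg ω C : ℂ) ^ j *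
      tridiagDet (-(aNeg ω C : ℂ)) (eta ω z) (-(aPos ω C : ℂ)) (n - j))) * this
  · intro j
    simp [blockA, blockB, Matrix.diagonal_apply, eq_comm]

/-! ### The boundary sum in terms of bulk roots -/

section BoundarySums

variable {ω C : ℝ} {Nα Nβ : ℕ} {α β : ℕ → ℝ}

theorem sum_boundaryCoeff_mul_pow (hα : ∀ j, Nα ≤ j → α j = 0) (hβ : ∀ j, Nβ ≤ j → β j = 0)
    {n : ℕ} (hnα : Nα ≤ n + 1) (hnβ : Nβ ≤ n + 1) (κ : ℂ → ℂ) (z : ℂ) :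
    ∑ j ∈ Finset.range (n + 1), boundaryCoeff α β z j * κ z ^ j =
      boundaryFunction Nα Nβ α β κ z := by
  have hext : ∀ (N : ℕ) (γ : ℕ → ℝ), (∀ j, N ≤ j → γ j = 0) → N ≤ n + 1 →
      ∑ j ∈ Finset.range N, (γ j : ℂ) * κ z ^ j =
        ∑ j ∈ Finset.range (n + 1), (γ j : ℂ) * κ z ^ j := by
    intro N γ hγ hN
    refine Finset.sum_subset (Finset.range_mono hN) fun j _ hj => ?_
    rw [hγ j (by simpa using hj)]
    simp
  rw [boundaryFunction, hext Nα α hα hnα, hext Nβ β hβ hnβ, Finset.mul_sum]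
  have hz : z = ∑ j ∈ Finset.range (n + 1), (if j = 0 then z else 0) * κ z ^ j := by
    simp [ite_mul]
  conv_rhs => rw [hz]
  rw [← Finset.sum_sub_distrib, ← hz, ← Finset.sum_sub_distrib]
  exact Finset.sum_congr rfl fun j _ => by rw [boundaryCoeff]; ring

theorem sum_boundary_of_aNeg_eq_zero (ha : aNeg ω C = 0) (n : ℕ) (z : ℂ) :
    ∑ j ∈ Finset.range (n + 1),
        boundaryCoeff α β z j * ((aNeg ω C : ℂ) ^ j * bulkDet ω C z (n - j)) =
      boundaryCoeff α β z 0 * eta ω z ^ n := by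
  rw [Finset.sum_eq_single 0]
  · rw [bulkDet, tridiagDet_of_mul_eq_zero _ _ _ (by simp [ha])]
    simp
  · intro j _ hj
    simp [ha, hj]
  · simp

theorem sum_boundary_of_aPos_eq_zero (hα : ∀ j, Nα ≤ j → α j = 0) (hβ : ∀ j, Nβ ≤ j → β j = 0)
    (ha : aPos ω C = 0) {n : ℕ} (hnα : Nα ≤ n + 1) (hnβ : Nβ ≤ n + 1) {z : ℂ}
    (hz : eta ω z ≠ 0) :
    ∑ j ∈ Finset.range (n + 1),
        boundaryCoeff α β z j * ((aNeg ω C : ℂ) ^ j * bulkDet ω C z (n - j)) =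
      eta ω z ^ n *
        boundaryFunction Nα Nβ α β (fun z => (aNeg ω C : ℂ) * (eta ω z)⁻¹) z := by
  rw [← sum_boundaryCoeff_mul_pow hα hβ hnα hnβ, Finset.mul_sum]
  refine Finset.sum_congr rfl fun j hj => ?_
  have hj' : j ≤ n := by simpa [Nat.lt_succ_iff] using hj
  rw [bulkDet, tridiagDet_of_mul_eq_zero _ _ _ (by simp [ha]), pow_sub₀ _ hz hj', mul_pow, inv_pow]
  ring

/-- In terms of the two bulk roots the boundary sum is a combination of the two boundary functions,
weighted by the powers of `a_1 κp` and `a_1 κm`. -/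
theorem sum_boundary_of_roots (hα : ∀ j, Nα ≤ j → α j = 0) (hβ : ∀ j, Nβ ≤ j → β j = 0)
    {n : ℕ} (hnα : Nα ≤ n + 1) (hnβ : Nβ ≤ n + 1) {κm κp : ℂ → ℂ} {z : ℂ}
    (hs : (aPos ω C : ℂ) * (κm z + κp z) = eta ω z)
    (hp : (aPos ω C : ℂ) * (κm z * κp z) = (aNeg ω C : ℂ)) :
    (∑ j ∈ Finset.range (n + 1),
        boundaryCoeff α β z j * ((aNeg ω C : ℂ) ^ j * bulkDet ω C z (n - j))) *
        (aPos ω C * κp z - aPos ω C * κm z) =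
      (aPos ω C * κp z) ^ (n + 1) * boundaryFunction Nα Nβ α β κm z -
        (aPos ω C * κm z) ^ (n + 1) * boundaryFunction Nα Nβ α β κp z := by
  rw [← sum_boundaryCoeff_mul_pow hα hβ hnα hnβ, ← sum_boundaryCoeff_mul_pow hα hβ hnα hnβ,
    Finset.mul_sum, Finset.mul_sum, ← Finset.sum_sub_distrib, Finset.sum_mul]
  refine Finset.sum_congr rfl fun j hj => ?_
  have hj' : j ≤ n := by simpa [Nat.lt_succ_iff] using hj
  have hD := tridiagDet_mul_sub (-(aNeg ω C : ℂ)) (eta ω z) (-(aPos ω C : ℂ))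
    (p := aPos ω C * κp z) (q := aPos ω C * κm z) (by rw [← hs]; ring) (by rw [← hp]; ring) (n - j)
  have e1 : (aPos ω C * κp z) ^ (n + 1) =
      (aPos ω C * κp z) ^ j * (aPos ω C * κp z) ^ (n - j + 1) := by
    rw [← pow_add]; congr 1; omega
  have e2 : (aPos ω C * κm z) ^ (n + 1) =
      (aPos ω C * κm z) ^ j * (aPos ω C * κm z) ^ (n - j + 1) := by
    rw [← pow_add]; congr 1; omega
  have e3 : (aNeg ω C : ℂ) ^ j = (aPos ω C * κp z) ^ j * κm z ^ j := by
    rw [← mul_pow, ← hp]; ring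
  have e4 : (aNeg ω C : ℂ) ^ j = (aPos ω C * κm z) ^ j * κp z ^ j := by
    rw [← mul_pow, ← hp]; ring
  rw [e1, e2, bulkDet]
  linear_combination boundaryCoeff α β z j * (aNeg ω C : ℂ) ^ j * hD +
    boundaryCoeff α β z j * (aPos ω C * κp z) ^ (n - j + 1) * e3 -
    boundaryCoeff α β z j * (aPos ω C * κm z) ^ (n - j + 1) * e4

end BoundarySums

/-! ### The asymptotic spectrum of the Toeplitz matrices -/

theorem polynomial_eq_of_eventually_eval_eq {P Q : ℂ[X]} {c : ℂ}
    (h : ∀ᶠ z in 𝓝 c, P.eval z = Q.eval z) : P = Q := by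
  refine Polynomial.eq_of_infinite_eval_eq P Q ?_
  exact infinite_of_mem_nhds c h

theorem sqrtProd_sq (ω C : ℝ) : sqrtProd ω C ^ 2 = (aNeg ω C : ℂ) * aPos ω C := by
  have := Complex.cpow_nat_inv_pow ((aNeg ω C * aPos ω C : ℝ) : ℂ) (two_ne_zero)
  rw [sqrtProd, one_div, ← Complex.ofReal_mul]
  exact_mod_cast this

theorem sqrtProd_ne_zero {ω C : ℝ} (ha : aNeg ω C ≠ 0) (hb : aPos ω C ≠ 0) :
    sqrtProd ω C ≠ 0 := by
  intro h
  have := sqrtProd_sq ω C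
  rw [h] at this
  simp [ha, hb] at this

theorem bulkDet_eq_chebyshev {ω C : ℝ} (ha : aNeg ω C ≠ 0) (hb : aPos ω C ≠ 0) (z : ℂ) (n : ℕ) :
    bulkDet ω C z n = sqrtProd ω C ^ n *
      (Chebyshev.U ℂ (n : ℤ)).eval (eta ω z / (2 * sqrtProd ω C)) := by
  have hs := sqrtProd_ne_zero ha hb
  rw [bulkDet]
  induction n using Nat.twoStepInduction with
  | zero => simp [tridiagDet_zero]
  | one => simp [tridiagDet_one]; field_simp
  | more n ih₁ ih₂ =>
    rw [tridiagDet_add_two, ih₁, ih₂]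
    push_cast
    rw [Chebyshev.U_add_two, neg_mul_neg, ← sqrtProd_sq]
    simp only [eval_sub, eval_mul, eval_X, eval_ofNat]
    field_simp
    ring

theorem analyticAt_eta (ω : ℝ) {c : ℂ} (hc : c ≠ 0) : AnalyticAt ℂ (eta ω) c :=
  analyticAt_id.sub (analyticAt_const.mul (analyticAt_id.inv hc))

theorem mul_eta (ω : ℝ) {z : ℂ} (hz : z ≠ 0) : z * eta ω z = z ^ 2 - bZero ω := by
  rw [eta]; field_simp

theorem eta_nhds_le_map (ω : ℝ) {c : ℂ} (hc : c ≠ 0) : 𝓝 (eta ω c) ≤ map (eta ω) (𝓝 c) := by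
  refine (analyticAt_eta ω hc).eventually_constant_or_nhds_le_map_nhds.resolve_left fun h => ?_
  have h' : ∀ᶠ z in 𝓝 c, (X ^ 2 - Polynomial.C (eta ω c) * X - Polynomial.C (bZero ω : ℂ)).eval z =
      (0 : ℂ[X]).eval z := by
    filter_upwards [h, isOpen_ne.mem_nhds hc] with z hz hz0
    have := mul_eta ω hz0
    rw [hz] at this
    simp only [eval_sub, eval_pow, eval_X, eval_mul, eval_C, eval_zero]
    linear_combination -this
  have h2 := congrArg (fun P => P.coeff 2) (polynomial_eq_of_eventually_eval_eq h')
  simp at h2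

theorem mem_eigenvalues_iff {n : Type*} [Fintype n] [DecidableEq n] (M : Matrix n n ℝ) (z : ℂ) :
    z ∈ eigenvalues M ↔ (M.map (algebraMap ℝ ℂ)).charpoly.eval z = 0 := by
  rw [eigenvalues, mem_roots (Matrix.charpoly_monic _).ne_zero, IsRoot]

/-- The zeros of the Chebyshev polynomials make the eigenvalues of the Toeplitz matrices
accumulate at every point where both bulk roots have the same modulus. -/
theorem mem_asymptoticSpectrum_toeplitzMatrix {ω C : ℝ} (ha : aNeg ω C ≠ 0) (hb : aPos ω C ≠ 0)
    {c p q : ℂ} (hc : c ≠ 0) (hs : p + q = eta ω c) (hp : p * q = aNeg ω C * aPos ω C)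
    (hpq : ‖p‖ = ‖q‖) : c ∈ asymptoticSpectrum (toeplitzMatrix ω C) := by
  have hs0 := sqrtProd_ne_zero ha hb
  set s := sqrtProd ω C with hsdef
  have hs2 : s ^ 2 = p * q := by rw [hp, hsdef, sqrtProd_sq]
  -- `p / s` lies on the unit circle and `q / s` is its inverse, hence its conjugate.
  have hnorm : ‖p / s‖ = 1 := by
    have h := congrArg norm hs2
    rw [norm_pow, norm_mul, ← hpq, ← sq, sq_eq_sq₀ (norm_nonneg _) (norm_nonneg _)] at h
    rw [norm_div, ← h, div_self (norm_ne_zero_iff.2 hs0)]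
  have hq : q / s = (starRingEnd ℂ) (p / s) := by
    have hp0 : p ≠ 0 := by rintro rfl; simp at hnorm
    rw [← Complex.inv_eq_conj hnorm]
    field_simp
    linear_combination -hs2
  have hη : eta ω c = 2 * s * ((p / s).re : ℂ) := by
    have : p / s + q / s = 2 * ((p / s).re : ℂ) := by rw [hq, Complex.add_conj]; push_cast; ring
    rw [← hs]
    field_simp at this ⊢
    linear_combination this
  set θ := Real.arccos (p / s).re
  have hre : |(p / s).re| ≤ 1 := hnorm ▸ Complex.abs_re_le_norm _
  have hcosθ : Real.cos θ = (p / s).re := Real.cos_arccos (abs_le.1 hre).1 (abs_le.1 hre).2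
  set φ : ℝ → ℂ := fun t => 2 * s * (Real.cos t : ℂ) with hφ
  have hφc : Continuous φ := by
    have := Complex.continuous_ofReal.comp Real.continuous_cos
    exact continuous_const.mul this
  intro δ hδ
  set V := eta ω '' (ball c δ ∩ {z | z ≠ 0}) with hV
  have hVn : V ∈ 𝓝 (eta ω c) := by
    refine eta_nhds_le_map ω hc (mem_map.2 (mem_of_superset ?_ (Set.subset_preimage_image _ _)))
    exact inter_mem (ball_mem_nhds c hδ) (isOpen_ne.mem_nhds hc)
  have hθV : φ ⁻¹' V ∈ 𝓝 θ := by
    refine hφc.continuousAt.preimage_mem_nhds ?_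
    rw [hφ]
    simp only [hcosθ, ← hη]
    exact hVn
  have hθcl : θ ∈ closure (Set.Ioo 0 Real.pi) := by
    rw [closure_Ioo Real.pi_ne_zero.symm]
    exact ⟨Real.arccos_nonneg _, Real.arccos_le_pi _⟩
  -- `θ` may be an endpoint of `[0, π]`, where the sine vanishes; move it into the interior.
  obtain ⟨θ', hθ'V, hθ'⟩ := mem_closure_iff_nhds.1 hθcl _ (interior_mem_nhds.2 hθV)
  have hW : interior (φ ⁻¹' V) ∩ Set.Ioo 0 Real.pi ∈ 𝓝 θ' :=
    (isOpen_interior.inter isOpen_Ioo).mem_nhds ⟨hθ'V, hθ'⟩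
  -- The angles `k π / (J + 1)` of the zeros of the Chebyshev polynomials approximate `θ'`.
  have hlim : Tendsto (fun J : ℕ =>
      (⌊θ' / Real.pi * ((J : ℝ) + 1)⌋₊ : ℝ) / ((J : ℝ) + 1) * Real.pi) atTop (𝓝 θ') := by
    have h1 : Tendsto (fun J : ℕ => (J : ℝ) + 1) atTop atTop :=
      tendsto_atTop_add_const_right _ _ tendsto_natCast_atTop_atTop
    have h2 := ((tendsto_nat_floor_mul_div_atTop (R := ℝ)
      (div_nonneg hθ'.1.le Real.pi_pos.le)).comp h1).mul_const Real.pi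
    rwa [div_mul_cancel₀ _ Real.pi_ne_zero] at h2
  refine Eventually.frequently ?_
  filter_upwards [hlim.eventually_mem hW] with J hJ
  set k : ℕ := ⌊θ' / Real.pi * ((J : ℝ) + 1)⌋₊
  set t : ℝ := (k : ℝ) / ((J : ℝ) + 1) * Real.pi with ht
  obtain ⟨hJV, hJπ⟩ := hJ
  obtain ⟨z, ⟨hzc, hz0⟩, hz⟩ := interior_subset hJV
  refine ⟨z, ?_, hzc⟩
  rw [mem_eigenvalues_iff, eval_charpoly_toeplitzMatrix _ _ _ hz0, bulkDet_eq_chebyshev ha hb, hz]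
  have harg : φ t / (2 * s) = Complex.cos (t : ℂ) := by
    rw [hφ]; push_cast; field_simp
  have hsin : Complex.sin (t : ℂ) ≠ 0 := by
    rw [← Complex.ofReal_sin]
    exact_mod_cast (Real.sin_pos_of_mem_Ioo hJπ).ne'
  have hU := Chebyshev.U_complex_cos (t : ℂ) (J : ℤ)
  have hkπ : (((J : ℤ) : ℂ) + 1) * (t : ℂ) = (k : ℂ) * Real.pi := by
    have : ((J : ℂ) + 1) ≠ 0 := by exact_mod_cast Nat.succ_ne_zero J
    rw [ht]; push_cast; field_simp
  rw [hkπ, Complex.sin_nat_mul_pi] at hU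
  rw [harg, (mul_eq_zero.1 hU).resolve_right hsin]
  simp

/-- If `a_{-1} a_1 = 0`, then `D_J = η ^ J`, so that a zero of `η` is an eigenvalue for every
`J ≥ 1`. -/
theorem eta_ne_zero_of_notMem {ω C : ℝ} (hab : aNeg ω C * aPos ω C = 0) {c : ℂ} (hc : c ≠ 0)
    (h : c ∉ asymptoticSpectrum (toeplitzMatrix ω C)) : eta ω c ≠ 0 := by
  refine fun h0 => h fun δ hδ => Eventually.frequently ?_
  filter_upwards [eventually_ge_atTop 1] with J hJ
  refine ⟨c, ?_, by simpa using hδ⟩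
  rw [mem_eigenvalues_iff, eval_charpoly_toeplitzMatrix _ _ _ hc, bulkDet,
    tridiagDet_of_mul_eq_zero _ _ _ (by rw [neg_mul_neg]; exact_mod_cast hab), h0,
    zero_pow (by omega), mul_zero]

/-! ### The roots of the bulk characteristic equation -/

/-- Near a point where they are distinct, the two roots of a quadratic equation with analytic
coefficients are analytic. -/
theorem exists_analyticAt_quadratic_roots {e : ℂ → ℂ} {c p q t : ℂ} (he : AnalyticAt ℂ e c)
    (hs : p + q = e c) (hp : p * q = t) (hpq : p ≠ q) :
    ∃ P Q : ℂ → ℂ, AnalyticAt ℂ P c ∧ AnalyticAt ℂ Q c ∧ P c = p ∧ Q c = q ∧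
      ∀ z, P z + Q z = e z ∧ P z * Q z = t := by
  have hd : p - q ≠ 0 := sub_ne_zero.2 hpq
  -- The discriminant, normalized to have the value `1` at `c`, where the principal square root is
  -- analytic.
  set X : ℂ → ℂ := fun z => (e z ^ 2 - 4 * t) / (p - q) ^ 2 with hX
  have hXc : X c = 1 := by
    rw [hX]
    simp only [← hs, ← hp]
    field_simp
    ring
  have hXa : AnalyticAt ℂ X c :=
    ((he.pow 2).sub analyticAt_const).div analyticAt_const (pow_ne_zero 2 hd)
  set δ : ℂ → ℂ := fun z => (p - q) * X z ^ (((2 : ℕ) : ℂ)⁻¹) with hδ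
  have hδa : AnalyticAt ℂ δ c :=
    analyticAt_const.mul (hXa.cpow analyticAt_const (by rw [hXc]; exact Complex.one_mem_slitPlane))
  have hδc : δ c = p - q := by simp [hδ, hXc]
  have hδ2 : ∀ z, δ z ^ 2 = e z ^ 2 - 4 * t := fun z => by
    rw [hδ]
    simp only [mul_pow, Complex.cpow_nat_inv_pow _ two_ne_zero, hX]
    field_simp
  refine ⟨fun z => (e z + δ z) / 2, fun z => (e z - δ z) / 2,
    (he.add hδa).div analyticAt_const two_ne_zero, (he.sub hδa).div analyticAt_const two_ne_zero,
    ?_, ?_, fun z => ⟨by ring, ?_⟩⟩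
  · simp only [hδc, ← hs]; ring
  · simp only [hδc, ← hs]; ring
  · linear_combination -(hδ2 z) / 4

/-- `κm z` and `κp z` are the two roots, with multiplicity, of the bulk characteristic equation at
`z`, expressed by Vieta's formulas. -/
def IsRootPair (ω C : ℝ) (κm κp : ℂ → ℂ) (z : ℂ) : Prop :=
  (aPos ω C : ℂ) * (κm z + κp z) = eta ω z ∧ (aPos ω C : ℂ) * (κm z * κp z) = (aNeg ω C : ℂ)

/-- Outside the asymptotic spectrum of the Toeplitz matrices the bulk roots have different moduli,
and so are distinct and locally analytic. -/
theorem exists_isRootPair {ω C : ℝ} (ha : aNeg ω C ≠ 0) (hb : aPos ω C ≠ 0) {c : ℂ} (hc : c ≠ 0)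
    (h : c ∉ asymptoticSpectrum (toeplitzMatrix ω C)) :
    ∃ κm κp : ℂ → ℂ, AnalyticAt ℂ κm c ∧ AnalyticAt ℂ κp c ∧ (∀ z, IsRootPair ω C κm κp z) ∧
      ‖κm c‖ < ‖κp c‖ := by
  have hb' : (aPos ω C : ℂ) ≠ 0 := by exact_mod_cast hb
  obtain ⟨p, q, hs, hp, hlt⟩ : ∃ p q : ℂ, p + q = eta ω c ∧
      p * q = (aNeg ω C : ℂ) * aPos ω C ∧ ‖p‖ < ‖q‖ := by
    obtain ⟨d, hd⟩ := IsAlgClosed.exists_pow_nat_eq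
      (eta ω c ^ 2 - 4 * ((aNeg ω C : ℂ) * aPos ω C)) two_pos
    have hs : (eta ω c - d) / 2 + (eta ω c + d) / 2 = eta ω c := by ring
    have hp : (eta ω c - d) / 2 * ((eta ω c + d) / 2) = (aNeg ω C : ℂ) * aPos ω C := by
      linear_combination -hd / 4
    rcases lt_trichotomy ‖(eta ω c - d) / 2‖ ‖(eta ω c + d) / 2‖ with hl | hl | hl
    · exact ⟨_, _, hs, hp, hl⟩
    · exact absurd (mem_asymptoticSpectrum_toeplitzMatrix ha hb hc hs hp hl) h
    · exact ⟨_, _, by rw [add_comm]; exact hs, by rw [mul_comm]; exact hp, hl⟩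
  obtain ⟨P, Q, hPa, hQa, hPc, hQc, hPQ⟩ := exists_analyticAt_quadratic_roots
    (analyticAt_eta ω hc) hs hp (by rintro rfl; exact lt_irrefl _ hlt)
  refine ⟨fun z => P z / aPos ω C, fun z => Q z / aPos ω C, hPa.div analyticAt_const hb',
    hQa.div analyticAt_const hb', fun z => ⟨?_, ?_⟩, ?_⟩
  · rw [← (hPQ z).1]; field_simp
  · have := (hPQ z).2
    field_simp
    linear_combination this
  · simp only [norm_div, hPc, hQc]
    exact div_lt_div_of_pos_right hlt (norm_pos_iff.2 hb')

/-- The Chebyshev ratio is the quotient of consecutive bulk determinants, which grow like the powers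
of `a_1 κp = a_{-1} / κm`, where `κm` is the root of smaller modulus. -/
theorem tendsto_chebyshevRatio {ω C : ℝ} (ha : aNeg ω C ≠ 0) (hb : aPos ω C ≠ 0)
    {κm κp : ℂ → ℂ} {z : ℂ} (h : IsRootPair ω C κm κp z) (hlt : ‖κm z‖ < ‖κp z‖) :
    Tendsto (fun J : ℕ => chebyshevRatio ω C z J) atTop (𝓝 (κm z / (aNeg ω C : ℂ))) := by
  have ha' : (aNeg ω C : ℂ) ≠ 0 := by exact_mod_cast ha
  have hb' : (aPos ω C : ℂ) ≠ 0 := by exact_mod_cast hb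
  have hp0 : κp z ≠ 0 := norm_pos_iff.1 ((norm_nonneg _).trans_lt hlt)
  have hs0 := sqrtProd_ne_zero ha hb
  obtain ⟨hs, hp⟩ := h
  set x := κm z / κp z with hx
  have hx1 : ‖x‖ < 1 := by rw [hx, norm_div]; exact (div_lt_one ((norm_nonneg _).trans_lt hlt)).2 hlt
  have hxn : ∀ n : ℕ, n ≠ 0 → 1 - x ^ n ≠ 0 := fun n hn h0 => by
    have h1 : x ^ n = 1 := (sub_eq_zero.1 h0).symm
    have := congrArg norm h1
    rw [norm_pow, norm_one] at this
    exact absurd this (pow_lt_one₀ (norm_nonneg _) hx1 hn).ne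
  have hD : ∀ n : ℕ, bulkDet ω C z n * (1 - x) =
      (aPos ω C * κp z) ^ n * (1 - x ^ (n + 1)) := fun n => by
    have := tridiagDet_mul_sub (-(aNeg ω C : ℂ)) (eta ω z) (-(aPos ω C : ℂ))
      (p := aPos ω C * κp z) (q := aPos ω C * κm z) (by rw [← hs]; ring) (by rw [← hp]; ring) n
    have hm : κm z = x * κp z := by rw [hx]; field_simp
    rw [hm] at this
    have h0 : (aPos ω C : ℂ) * κp z ≠ 0 := mul_ne_zero hb' hp0
    rw [bulkDet]
    apply mul_left_cancel₀ h0
    linear_combination this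
  have hev : (fun J : ℕ => κm z / (aNeg ω C : ℂ) * ((1 - x ^ J) / (1 - x ^ (J + 1)))) =ᶠ[atTop]
      fun J : ℕ => chebyshevRatio ω C z J := by
    filter_upwards [eventually_ge_atTop 1] with J hJ
    obtain ⟨n, rfl⟩ : ∃ n, J = n + 1 := ⟨J - 1, by omega⟩
    have h1 := hD n
    have h2 := hD (n + 1)
    rw [bulkDet_eq_chebyshev ha hb] at h1 h2
    have h1x : (1 - x) ≠ 0 := by simpa using hxn 1 one_ne_zero
    have hn2 := hxn (n + 1 + 1) (by omega)
    rw [chebyshevRatio, show (((n + 1 : ℕ) : ℤ) - 1) = (n : ℤ) by push_cast; ring]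
    set U1 := (Chebyshev.U ℂ (n : ℤ)).eval (eta ω z / (2 * sqrtProd ω C))
    set U2 := (Chebyshev.U ℂ ((n + 1 : ℕ) : ℤ)).eval (eta ω z / (2 * sqrtProd ω C))
    have hbp : (aPos ω C : ℂ) * κp z ≠ 0 := mul_ne_zero hb' hp0
    have hU2 : U2 ≠ 0 := by
      intro h0
      rw [h0] at h2
      simp [hbp, hn2] at h2
    have e1 : U1 = (aPos ω C * κp z) ^ n * (1 - x ^ (n + 1)) / (sqrtProd ω C ^ n * (1 - x)) := by
      rw [eq_div_iff (mul_ne_zero (pow_ne_zero _ hs0) h1x)]; linear_combination h1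
    have e2 : U2 = (aPos ω C * κp z) ^ (n + 1) * (1 - x ^ (n + 1 + 1)) /
        (sqrtProd ω C ^ (n + 1) * (1 - x)) := by
      rw [eq_div_iff (mul_ne_zero (pow_ne_zero _ hs0) h1x)]; linear_combination h2
    rw [e1, e2, ← hp]
    have hm0 : κm z ≠ 0 := by rintro h0; rw [h0] at hp; simp at hp; exact ha' hp.symm
    rw [pow_succ (aPos ω C * κp z), pow_succ (sqrtProd ω C)]
    field_simp
  have hxt := tendsto_pow_atTop_nhds_zero_of_norm_lt_one hx1
  have h1 : Tendsto (fun J : ℕ => (1 - x ^ J) / (1 - x ^ (J + 1))) atTop (𝓝 ((1 - 0) / (1 - 0))) :=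
    (tendsto_const_nhds.sub hxt).div
      (tendsto_const_nhds.sub (hxt.comp (tendsto_add_atTop_nat 1))) (by simp)
  have h2 := h1.const_mul (κm z / (aNeg ω C : ℂ))
  simp only [sub_zero, div_one, mul_one] at h2
  exact h2.congr' hev

/-- A continuous root which takes the value of one of two distinct continuous roots at one point of
a ball agrees with it on the whole ball. -/
theorem eqOn_of_bulkCharEq {ω C : ℝ} (hb : aPos ω C ≠ 0) {c : ℂ} {ε : ℝ} {κ κm κp : ℂ → ℂ}
    (hκ : ContinuousOn κ (closedBall c ε)) (hchar : ∀ z ∈ closedBall c ε, BulkCharEq ω C z (κ z))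
    (hκm : ContinuousOn κm (closedBall c ε)) (hκp : ContinuousOn κp (closedBall c ε))
    (hpair : ∀ z ∈ closedBall c ε, IsRootPair ω C κm κp z)
    (hne : ∀ z ∈ closedBall c ε, κm z ≠ κp z) {w : ℂ} (hw : w ∈ closedBall c ε)
    (hκw : κ w = κm w) : Set.EqOn κ κm (closedBall c ε) := by
  have hb' : (aPos ω C : ℂ) ≠ 0 := by exact_mod_cast hb
  have h := (convex_closedBall c ε).isPreconnected.eq_of_sq_eq
    (f := fun z => 2 * κ z - (κm z + κp z)) (g := fun z => κm z - κp z)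
    ((continuousOn_const.mul hκ).sub (hκm.add hκp)) (hκm.sub hκp) ?_
    (fun {z} hz => sub_ne_zero.2 (hne z hz)) hw (by simp only [hκw]; ring)
  · intro z hz
    have := h hz
    simp only at this
    linear_combination this / 2
  · intro z hz
    obtain ⟨hs, hp⟩ := hpair z hz
    have hc := hchar z hz
    rw [BulkCharEq, ← hs, ← hp] at hc
    apply mul_left_cancel₀ hb'
    simp only [Pi.pow_apply]
    linear_combination -4 * hc

/-! ### Boundary functions which do not vanish identically -/

theorem analyticAt_boundaryFunction (Nα Nβ : ℕ) (α β : ℕ → ℝ) {κ : ℂ → ℂ} {z : ℂ} (hz : z ≠ 0)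
    (hκ : AnalyticAt ℂ κ z) : AnalyticAt ℂ (boundaryFunction Nα Nβ α β κ) z := by
  have hsum : ∀ (N : ℕ) (γ : ℕ → ℝ),
      AnalyticAt ℂ (fun z => ∑ i ∈ Finset.range N, (γ i : ℂ) * κ z ^ i) z := fun N γ =>
    Finset.analyticAt_fun_sum _ fun i _ => analyticAt_const.mul (hκ.pow i)
  exact (analyticAt_id.sub (hsum Nα α)).sub ((analyticAt_id.inv hz).mul (hsum Nβ β))

theorem boundaryFunction_congr (Nα Nβ : ℕ) (α β : ℕ → ℝ) {κ κ' : ℂ → ℂ} {z : ℂ}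
    (h : κ z = κ' z) : boundaryFunction Nα Nβ α β κ z = boundaryFunction Nα Nβ α β κ' z := by
  simp only [boundaryFunction, h]

/-- The characteristic polynomial of the complexified scheme matrix. -/
noncomputable def schemeCharpoly (ω C : ℝ) (α β : ℕ → ℝ) (J : ℕ) : ℂ[X] :=
  ((schemeMatrix ω C α β J).map (algebraMap ℝ ℂ)).charpoly

theorem schemeCharpoly_ne_zero (ω C : ℝ) (α β : ℕ → ℝ) (J : ℕ) : schemeCharpoly ω C α β J ≠ 0 :=
  (Matrix.charpoly_monic _).ne_zero

/-- With `s ^ 2 = a_{-1} a_1`, the discriminant of the bulk characteristic equation, multiplied by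
`z ^ 2`, is `(z ^ 2 - b_0 - 2 s z) (z ^ 2 - b_0 + 2 s z)`. Both factors have the discriminant
`ω ^ 2 (1 - C ^ 2)` up to a constant, and for `s ≠ 0` they share at most the zero `0`. -/
theorem exists_simple_root_discriminant {ω C : ℝ} (hω : ω ≠ 0) (hC : |C| < 1)
    (ha : aNeg ω C ≠ 0) (hb : aPos ω C ≠ 0) :
    ∃ r : ℂ, ((X ^ 2 - Polynomial.C (bZero ω : ℂ)) ^ 2 -
      4 * Polynomial.C ((aNeg ω C : ℂ) * aPos ω C) * X ^ 2 : ℂ[X]).rootMultiplicity r = 1 := by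
  have hs0 := sqrtProd_ne_zero ha hb
  have hs2 := sqrtProd_sq ω C
  set s := sqrtProd ω C
  have hC2 : 0 < 1 - C ^ 2 := by nlinarith [abs_lt.1 hC, sq_abs C, abs_nonneg C]
  obtain ⟨d, hd, hd0, hsd⟩ : ∃ d : ℂ, d ^ 2 = s ^ 2 + bZero ω ∧ d ≠ 0 ∧ s + d ≠ 0 := by
    obtain ⟨d, hd⟩ := IsAlgClosed.exists_pow_nat_eq (s ^ 2 + (bZero ω : ℂ)) two_pos
    have hd0 : d ≠ 0 := by
      rintro rfl
      have h1 : ((ω ^ 2 * (1 - C ^ 2) / 4 : ℝ) : ℂ) = 0 := by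
        rw [hs2] at hd
        rw [zero_pow two_ne_zero] at hd
        rw [hd]
        push_cast [aNeg, aPos, bZero]
        ring
      have h2 : ω ^ 2 * (1 - C ^ 2) / 4 = 0 := by exact_mod_cast h1
      have : 0 < ω ^ 2 := by positivity
      nlinarith [mul_pos this hC2]
    by_cases h : s + d = 0
    · refine ⟨-d, by rw [neg_sq, hd], neg_ne_zero.2 hd0, fun h' => hs0 ?_⟩
      linear_combination (h + h') / 2
    · exact ⟨d, hd, hd0, h⟩
  set W : ℂ[X] := (X ^ 2 - Polynomial.C (bZero ω : ℂ)) ^ 2 -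
    4 * Polynomial.C ((aNeg ω C : ℂ) * aPos ω C) * X ^ 2 with hW
  have hWr : W.eval (s + d) = 0 := by
    simp only [hW, ← hs2, eval_sub, eval_pow, eval_mul, eval_X, eval_C, eval_ofNat]
    linear_combination (d ^ 2 + 4 * s * d + 3 * s ^ 2 - bZero ω) * hd
  have hWr' : (derivative W).eval (s + d) ≠ 0 := by
    have : (derivative W).eval (s + d) = 8 * d * s * (s + d) := by
      simp only [hW, ← hs2, derivative_sub, derivative_mul, derivative_pow, derivative_X,
        derivative_C, derivative_ofNat, eval_sub, eval_pow, eval_mul, eval_X, eval_C, eval_ofNat,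
        eval_add, eval_zero, eval_one, map_natCast, eval_natCast]
      push_cast
      linear_combination 4 * (s + d) * hd
    rw [this]
    exact mul_ne_zero (mul_ne_zero (mul_ne_zero (by norm_num) hd0) hs0) hsd
  have hW0 : W ≠ 0 := by rintro h; rw [h] at hWr'; simp at hWr'
  refine ⟨s + d, le_antisymm ?_ ((rootMultiplicity_pos hW0).2 hWr)⟩
  by_contra hlt
  exact hWr' ((one_lt_rootMultiplicity_iff_isRoot hW0).1 (not_le.1 hlt)).2

/-- If the boundary function of one root vanishes identically, then the other root is a rational
function, so that the discriminant of the bulk characteristic equation is a square. For `|C| < 1`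
it has a simple zero. -/
theorem not_eventually_boundaryFunction_eq_zero {ω C : ℝ} {Nα Nβ : ℕ} {α β : ℕ → ℝ} (hω : ω ≠ 0)
    (hC : |C| < 1) (ha : aNeg ω C ≠ 0) (hb : aPos ω C ≠ 0)
    (hα : ∀ j, Nα ≤ j → α j = 0) (hβ : ∀ j, Nβ ≤ j → β j = 0) {c : ℂ} (hc : c ≠ 0)
    {κm κp : ℂ → ℂ} (hpair : ∀ᶠ z in 𝓝 c, IsRootPair ω C κm κp z)
    (hne : ∀ᶠ z in 𝓝 c, κm z ≠ κp z) :
    ¬ ∀ᶠ z in 𝓝 c, boundaryFunction Nα Nβ α β κm z = 0 := by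
  intro h0
  have hb' : (aPos ω C : ℂ) ≠ 0 := by exact_mod_cast hb
  set n := Nα + Nβ
  set P₁ := schemeCharpoly ω C α β (n + 2) with hP₁
  set P₂ := schemeCharpoly ω C α β (n + 1 + 2) with hP₂
  set W : ℂ[X] := (X ^ 2 - Polynomial.C (bZero ω : ℂ)) ^ 2 -
      4 * Polynomial.C ((aNeg ω C : ℂ) * aPos ω C) * X ^ 2 with hW
  have hid : (2 * P₂ - (X ^ 2 - Polynomial.C (bZero ω : ℂ)) * P₁) *
      (2 * P₂ - (X ^ 2 - Polynomial.C (bZero ω : ℂ)) * P₁) = P₁ * P₁ * W := by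
    refine polynomial_eq_of_eventually_eval_eq (c := c) ?_
    filter_upwards [h0, hpair, hne, isOpen_ne.mem_nhds hc] with z hz hzp hzne hz0
    have hd : (aPos ω C : ℂ) * κp z - aPos ω C * κm z ≠ 0 := by
      rw [← mul_sub]
      exact mul_ne_zero hb' (sub_ne_zero.2 hzne.symm)
    have e₁ := sum_boundary_of_roots hα hβ (n := n) (by omega) (by omega) hzp.1 hzp.2
    have e₂ := sum_boundary_of_roots hα hβ (n := n + 1) (by omega) (by omega) hzp.1 hzp.2
    -- Only the power of `a_1 κm` is left in the characteristic polynomials, so that the quotient of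
    -- two consecutive ones is `z a_1 κm`.
    have hstep : P₂.eval z = z * (aPos ω C * κm z) * P₁.eval z := by
      rw [hP₁, hP₂, schemeCharpoly, schemeCharpoly, eval_charpoly_schemeMatrix _ _ _ _ _ hz0,
        eval_charpoly_schemeMatrix _ _ _ _ _ hz0]
      apply mul_right_cancel₀ hd
      rw [hz] at e₁ e₂
      linear_combination z ^ (n + 4) * e₂ - z * (aPos ω C * κm z) * z ^ (n + 3) * e₁
    obtain ⟨hs, hp⟩ := hzp
    have hmul := mul_eta ω hz0
    simp only [hW, eval_sub, eval_pow, eval_mul, eval_X, eval_C, eval_ofNat, hstep]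
    rw [← hmul, ← hs, ← hp]
    ring
  obtain ⟨r, hr⟩ := exists_simple_root_discriminant hω hC ha hb
  have hP0 : P₁ ≠ 0 := schemeCharpoly_ne_zero _ _ _ _ _
  have hW0 : W ≠ 0 := by rintro h; rw [← hW, h] at hr; simp at hr
  have hR0 : P₁ * P₁ * W ≠ 0 := mul_ne_zero (mul_ne_zero hP0 hP0) hW0
  -- The left side has even multiplicity at `r`, the right side odd multiplicity.
  have hcount := congrArg (rootMultiplicity r) hid
  rw [rootMultiplicity_mul (by rw [hid]; exact hR0), rootMultiplicity_mul hR0,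
    rootMultiplicity_mul (mul_ne_zero hP0 hP0), hr] at hcount
  omega

/-! ### Counting the eigenvalues of the scheme matrix -/

theorem eventually_hasZeroOfOrder {ω C : ℝ} {α β : ℕ → ℝ} {c : ℂ} {ε r : ℝ} (hε : 0 < ε)
    (hr : ε < r) {u h : ℕ → ℂ → ℂ} {f : ℂ → ℂ} (hfa : AnalyticAt ℂ f c)
    (hf : ¬ ∀ᶠ z in 𝓝 c, f z = 0)
    (hP : ∀ᶠ J in atTop, ∀ z ∈ ball c r, (schemeCharpoly ω C α β J).eval z = u J z * h J z)
    (hu : ∀ᶠ J in atTop, DifferentiableOn ℂ (u J) (ball c r))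
    (hu0 : ∀ᶠ J in atTop, ∀ z ∈ ball c r, u J z ≠ 0)
    (hh : ∀ᶠ J in atTop, DifferentiableOn ℂ (h J) (ball c r))
    (hlim : TendstoLocallyUniformlyOn h f atTop (ball c r))
    (h0 : ∀ z ∈ ball c r, z ≠ c → f z ≠ 0) :
    ∀ᶠ J in atTop, HasZeroOfOrder f c (eigenvalueCount (schemeMatrix ω C α β J) c ε) := by
  have htop : analyticOrderAt f c ≠ ⊤ := fun h => hf (analyticOrderAt_eq_top.1 h)
  have hm : analyticOrderAt f c = (analyticOrderNatAt f c : ℕ∞) :=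
    (Nat.cast_analyticOrderNatAt htop).symm
  filter_upwards [eventually_countP_roots_eq_order hε hr hP hu hu0 hh hlim h0 hm] with J hJ
  refine ⟨hfa, ?_⟩
  rw [hm, ← hJ]
  rfl

/-- The case in which the characteristic polynomials are, up to nonvanishing factors, the same
function `f` for all large `J`. -/
theorem exists_hasZeroOfOrder_of_factor {ω C : ℝ} {α β : ℕ → ℝ} {c : ℂ} {u : ℕ → ℂ → ℂ}
    {f : ℂ → ℂ} (hfa : AnalyticAt ℂ f c) {J₀ : ℕ}
    (h : ∀ᶠ z in 𝓝 c, ∀ J ≥ J₀, (schemeCharpoly ω C α β J).eval z = u J z * f z ∧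
      AnalyticAt ℂ (u J) z ∧ u J z ≠ 0) :
    ∃ ε₀ : ℝ, 0 < ε₀ ∧ ∀ ε : ℝ, 0 < ε → ε < ε₀ → ∀ᶠ J in atTop,
      HasZeroOfOrder f c (eigenvalueCount (schemeMatrix ω C α β J) c ε) := by
  have hf : ¬ ∀ᶠ z in 𝓝 c, f z = 0 := by
    intro hf
    refine schemeCharpoly_ne_zero ω C α β J₀ (polynomial_eq_of_eventually_eval_eq (c := c) ?_)
    filter_upwards [h, hf] with z hz hfz
    rw [(hz J₀ le_rfl).1, hfz, mul_zero, eval_zero]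
  have hne := hfa.eventually_eq_zero_or_eventually_ne_zero.resolve_left hf
  rw [eventually_nhdsWithin_iff] at hne
  obtain ⟨r, hr, hball⟩ := eventually_nhds_iff_ball.1 (h.and (hne.and hfa.eventually_analyticAt))
  refine ⟨r, hr, fun ε hε hεr => ?_⟩
  have hfd : DifferentiableOn ℂ f (ball c r) := fun z hz =>
    (hball z hz).2.2.differentiableAt.differentiableWithinAt
  refine eventually_hasZeroOfOrder (h := fun _ => f) (u := u) hε hεr hfa hf ?_ ?_ ?_ ?_ ?_ ?_
  · filter_upwards [eventually_ge_atTop J₀] with J hJ z hz using ((hball z hz).1 J hJ).1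
  · filter_upwards [eventually_ge_atTop J₀] with J hJ z hz using
      ((hball z hz).1 J hJ).2.1.differentiableAt.differentiableWithinAt
  · filter_upwards [eventually_ge_atTop J₀] with J hJ z hz using ((hball z hz).1 J hJ).2.2
  · exact Eventually.of_forall fun _ => hfd
  · refine TendstoUniformlyOn.tendstoLocallyUniformlyOn ?_
    rw [Metric.tendstoUniformlyOn_iff]
    exact fun δ hδ => Eventually.of_forall fun _ z _ => by simpa using hδ
  · exact fun z hz hzc => (hball z hz).2.1 hzc

theorem eventually_eta_ne_zero {ω : ℝ} {c : ℂ} (hc : c ≠ 0) (hη : eta ω c ≠ 0) :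
    ∀ᶠ z in 𝓝 c, z ≠ 0 ∧ eta ω z ≠ 0 :=
  (eventually_ne_nhds hc).and ((analyticAt_eta ω hc).continuousAt.eventually_ne hη)

theorem analyticAt_pow_mul_eta_pow (ω : ℝ) {z : ℂ} (hz : z ≠ 0) (k l : ℕ) :
    AnalyticAt ℂ (fun z => z ^ k * eta ω z ^ l) z :=
  (analyticAt_id.pow k).mul ((analyticAt_eta ω hz).pow l)

theorem exists_hasZeroOfOrder_of_aNeg_eq_zero {ω C : ℝ} {α β : ℕ → ℝ} {c : ℂ} (hc : c ≠ 0)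
    (hη : eta ω c ≠ 0) (ha : aNeg ω C = 0) :
    ∃ ε₀ : ℝ, 0 < ε₀ ∧ ∀ ε : ℝ, 0 < ε → ε < ε₀ → ∀ᶠ J in atTop,
      HasZeroOfOrder (fun z : ℂ => (z ^ 2 - (α 0 : ℂ) * z - (β 0 : ℂ)) /
        (z ^ 2 - ((ω - 1 : ℝ) : ℂ))) c (eigenvalueCount (schemeMatrix ω C α β J) c ε) := by
  have hden : ∀ z : ℂ, z ≠ 0 → z ^ 2 - ((ω - 1 : ℝ) : ℂ) = z * eta ω z := fun z hz => by
    rw [mul_eta ω hz, bZero]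
  refine exists_hasZeroOfOrder_of_factor (J₀ := 2)
    (u := fun J z => z ^ (J + 1) * eta ω z ^ (J - 1)) ?_ ?_
  · refine AnalyticAt.div (by fun_prop) (by fun_prop) ?_
    rw [hden c hc]
    exact mul_ne_zero hc hη
  · filter_upwards [eventually_eta_ne_zero hc hη] with z ⟨hz, hηz⟩ J hJ
    obtain ⟨n, rfl⟩ : ∃ n, J = n + 2 := ⟨J - 2, by omega⟩
    refine ⟨?_, analyticAt_pow_mul_eta_pow ω hz _ _,
      mul_ne_zero (pow_ne_zero _ hz) (pow_ne_zero _ hηz)⟩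
    rw [schemeCharpoly, eval_charpoly_schemeMatrix _ _ _ _ _ hz, sum_boundary_of_aNeg_eq_zero ha,
      hden z hz, boundaryCoeff, if_pos rfl, show n + 2 - 1 = n + 1 by omega]
    field_simp
    ring

theorem exists_hasZeroOfOrder_of_aPos_eq_zero {ω C : ℝ} {Nα Nβ : ℕ} {α β : ℕ → ℝ}
    (hα : ∀ j, Nα ≤ j → α j = 0) (hβ : ∀ j, Nβ ≤ j → β j = 0) {c : ℂ} (hc : c ≠ 0)
    (hη : eta ω c ≠ 0) (hb : aPos ω C = 0) :
    ∃ ε₀ : ℝ, 0 < ε₀ ∧ ∀ ε : ℝ, 0 < ε → ε < ε₀ → ∀ᶠ J in atTop,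
      HasZeroOfOrder (boundaryFunction Nα Nβ α β fun z => (aNeg ω C : ℂ) * (eta ω z)⁻¹) c
        (eigenvalueCount (schemeMatrix ω C α β J) c ε) := by
  refine exists_hasZeroOfOrder_of_factor (J₀ := Nα + Nβ + 2)
    (u := fun J z => z ^ (J + 1) * eta ω z ^ (J - 2)) ?_ ?_
  · exact analyticAt_boundaryFunction _ _ _ _ hc
      (analyticAt_const.mul ((analyticAt_eta ω hc).inv hη))
  · filter_upwards [eventually_eta_ne_zero hc hη] with z ⟨hz, hηz⟩ J hJ
    obtain ⟨n, rfl⟩ : ∃ n, J = n + 2 := ⟨J - 2, by omega⟩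
    refine ⟨?_, analyticAt_pow_mul_eta_pow ω hz _ _,
      mul_ne_zero (pow_ne_zero _ hz) (pow_ne_zero _ hηz)⟩
    rw [schemeCharpoly, eval_charpoly_schemeMatrix _ _ _ _ _ hz,
      sum_boundary_of_aPos_eq_zero hα hβ hb (by omega) (by omega) hηz,
      show n + 2 - 2 = n by omega, mul_assoc]

/-! ### The reflection coefficient -/

theorem hasPoleOfOrder_reflectionCoefficient {ω C : ℝ} {Nα Nβ : ℕ} {α β : ℕ → ℝ} {c : ℂ}
    (hc : c ≠ 0) (hb : aPos ω C ≠ 0) {κ κm κp : ℂ → ℂ} (hκ : AnalyticAt ℂ κ c) {m : ℕ}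
    (hm : HasZeroOfOrder (boundaryFunction Nα Nβ α β κ) c m)
    (hpair : AreTheTwoRootsNear ω C c κm κp) (hκm : κm =ᶠ[𝓝 c] κ)
    (h0 : boundaryFunction Nα Nβ α β κp c ≠ 0) :
    HasPoleOfOrder (reflectionCoefficient Nα Nβ α β κm κp) c m := by
  have hb' : (aPos ω C : ℂ) ≠ 0 := by exact_mod_cast hb
  have hκma : AnalyticAt ℂ κm c := hκ.congr hκm.symm
  have hκp : κp =ᶠ[𝓝 c] fun z => eta ω z / aPos ω C - κm z := by
    filter_upwards [hpair] with z hz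
    rw [← hz.1]; field_simp; ring
  have hκpa : AnalyticAt ℂ κp c :=
    (((analyticAt_eta ω hc).div analyticAt_const hb').sub hκma).congr hκp.symm
  have hFm := analyticAt_boundaryFunction Nα Nβ α β hc hκma
  have hFp := analyticAt_boundaryFunction Nα Nβ α β hc hκpa
  have hFm_eq : boundaryFunction Nα Nβ α β κm =ᶠ[𝓝 c] boundaryFunction Nα Nβ α β κ := by
    filter_upwards [hκm] with z hz using boundaryFunction_congr _ _ _ _ hz
  have hmer : MeromorphicAt
      (boundaryFunction Nα Nβ α β κp / boundaryFunction Nα Nβ α β κm) c :=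
    hFp.meromorphicAt.div hFm.meromorphicAt
  have hR : reflectionCoefficient Nα Nβ α β κm κp =
      -(boundaryFunction Nα Nβ α β κp / boundaryFunction Nα Nβ α β κm) := rfl
  refine ⟨hR ▸ hmer.neg, ?_⟩
  rw [hR, ← meromorphicOrderAt_neg, meromorphicOrderAt_div hFp.meromorphicAt hFm.meromorphicAt,
    hFp.meromorphicOrderAt_eq, hFm.meromorphicOrderAt_eq, analyticOrderAt_congr hFm_eq, hm.2,
    hFp.analyticOrderAt_eq_zero.2 h0]
  simp

/-! ### Two nonzero bulk coefficients -/

/-- With the roots numbered so that `κm` has the smaller modulus, the characteristic polynomials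
are, up to nonvanishing factors, `F_κm - (κm / κp) ^ (J - 1) * F_κp`, which converges to `F_κm`. -/
theorem exists_radius_of_isRootPair {ω C : ℝ} {Nα Nβ : ℕ} {α β : ℕ → ℝ}
    (hb : aPos ω C ≠ 0)
    (hα : ∀ j, Nα ≤ j → α j = 0) (hβ : ∀ j, Nβ ≤ j → β j = 0) {c : ℂ} (hc : c ≠ 0)
    {κm κp : ℂ → ℂ} (hm : AnalyticAt ℂ κm c) (hp : AnalyticAt ℂ κp c)
    (hpair : ∀ z, IsRootPair ω C κm κp z) (hlt : ‖κm c‖ < ‖κp c‖) :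
    ∃ ε₀ : ℝ, 0 < ε₀ ∧ (∀ z ∈ ball c ε₀, AnalyticAt ℂ κm z ∧ AnalyticAt ℂ κp z ∧
      ‖κm z‖ < ‖κp z‖) ∧
      ((¬ ∀ᶠ z in 𝓝 c, boundaryFunction Nα Nβ α β κm z = 0) → ∀ ε : ℝ, 0 < ε → ε < ε₀ →
        ∀ᶠ J in atTop, HasZeroOfOrder (boundaryFunction Nα Nβ α β κm) c
          (eigenvalueCount (schemeMatrix ω C α β J) c ε)) := by
  have hb' : (aPos ω C : ℂ) ≠ 0 := by exact_mod_cast hb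
  set Fm := boundaryFunction Nα Nβ α β κm
  set Fp := boundaryFunction Nα Nβ α β κp
  have hFm : AnalyticAt ℂ Fm c := analyticAt_boundaryFunction _ _ _ _ hc hm
  have hFp : AnalyticAt ℂ Fp c := analyticAt_boundaryFunction _ _ _ _ hc hp
  -- Uniform bounds `‖κm / κp‖ < ρ < 1` and `‖Fp‖ < M` hold near `c`.
  obtain ⟨ρ, hρ, hρ1⟩ := exists_between ((div_lt_one ((norm_nonneg _).trans_lt hlt)).2 hlt)
  have hρ0 : 0 < ρ := (div_nonneg (norm_nonneg _) (norm_nonneg _)).trans_lt hρ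
  have hp0 : κp c ≠ 0 := norm_pos_iff.1 ((norm_nonneg _).trans_lt hlt)
  have hratio : ∀ᶠ z in 𝓝 c, ‖κm z / κp z‖ < ρ :=
    (hm.continuousAt.div hp.continuousAt hp0).norm.eventually_lt_const (by simpa using hρ)
  have hbound : ∀ᶠ z in 𝓝 c, ‖Fp z‖ < ‖Fp c‖ + 1 :=
    hFp.continuousAt.norm.eventually_lt_const (lt_add_one _)
  have hzero : ∀ᶠ z in 𝓝 c, (¬ ∀ᶠ z in 𝓝 c, Fm z = 0) → z ≠ c → Fm z ≠ 0 := by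
    rcases hFm.eventually_eq_zero_or_eventually_ne_zero with h | h
    · exact Eventually.of_forall fun z h' => absurd h h'
    · filter_upwards [eventually_nhdsWithin_iff.1 h] with z hz _ hzc using hz hzc
  obtain ⟨r, hr, hball⟩ := eventually_nhds_iff_ball.1
    (hratio.and (hbound.and (hzero.and (hm.eventually_analyticAt.and
      (hp.eventually_analyticAt.and ((hp.continuousAt.eventually_ne hp0).and
        (eventually_ne_nhds hc)))))))
  have hlt' : ∀ z ∈ ball c r, ‖κm z‖ < ‖κp z‖ := fun z hz => by
    obtain ⟨h1, -, -, -, -, h2, -⟩ := hball z hz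
    rw [norm_div] at h1
    exact (div_lt_one (norm_pos_iff.2 h2)).1 (h1.trans hρ1)
  refine ⟨r, hr, fun z hz => ⟨(hball z hz).2.2.2.1, (hball z hz).2.2.2.2.1, hlt' z hz⟩,
    fun hF ε hε hεr => ?_⟩
  have hd0 : ∀ z ∈ ball c r, (aPos ω C : ℂ) * κp z - aPos ω C * κm z ≠ 0 := fun z hz => by
    rw [← mul_sub]
    refine mul_ne_zero hb' (sub_ne_zero.2 fun h => ?_)
    exact (hlt' z hz).ne (by rw [h])
  refine eventually_hasZeroOfOrder
    (u := fun J z => z ^ (J + 1) * (aPos ω C * κp z) ^ (J - 1) /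
      (aPos ω C * κp z - aPos ω C * κm z))
    (h := fun J z => Fm z - (κm z / κp z) ^ (J - 1) * Fp z) hε hεr hFm hF ?_ ?_ ?_ ?_ ?_ ?_
  · filter_upwards [eventually_ge_atTop (Nα + Nβ + 2)] with J hJ z hz
    obtain ⟨n, rfl⟩ : ∃ n, J = n + 2 := ⟨J - 2, by omega⟩
    obtain ⟨-, -, -, -, -, hpz, hz0⟩ := hball z hz
    have hsum := sum_boundary_of_roots hα hβ (n := n) (by omega) (by omega) (hpair z).1 (hpair z).2
    rw [schemeCharpoly, eval_charpoly_schemeMatrix _ _ _ _ _ hz0, div_mul_eq_mul_div,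
      eq_div_iff (hd0 z hz), mul_assoc, hsum, show n + 2 - 1 = n + 1 by omega]
    have hpow : (κm z / κp z) ^ (n + 1) * (aPos ω C * κp z) ^ (n + 1) =
        (aPos ω C * κm z) ^ (n + 1) := by
      rw [← mul_pow]; congr 1; field_simp
    rw [← hpow]
    ring
  · refine Eventually.of_forall fun J z hz => ?_
    obtain ⟨-, -, -, hmz, hpz, -, -⟩ := hball z hz
    exact (((analyticAt_id.pow _).mul ((analyticAt_const.mul hpz).pow _)).div
      ((analyticAt_const.mul hpz).sub (analyticAt_const.mul hmz))
        (hd0 z hz)).differentiableAt.differentiableWithinAt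
  · refine Eventually.of_forall fun J z hz => ?_
    obtain ⟨-, -, -, -, -, hpz, hz0⟩ := hball z hz
    exact div_ne_zero (mul_ne_zero (pow_ne_zero _ hz0) (pow_ne_zero _ (mul_ne_zero hb' hpz)))
      (hd0 z hz)
  · refine Eventually.of_forall fun J z hz => ?_
    obtain ⟨-, -, -, hmz, hpz, hp0z, hz0⟩ := hball z hz
    exact ((analyticAt_boundaryFunction _ _ _ _ hz0 hmz).sub (((hmz.div hpz hp0z).pow _).mul
      (analyticAt_boundaryFunction _ _ _ _ hz0 hpz))).differentiableAt.differentiableWithinAt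
  · refine TendstoUniformlyOn.tendstoLocallyUniformlyOn ?_
    rw [Metric.tendstoUniformlyOn_iff]
    intro δ hδ
    have hgeo : Tendsto (fun J : ℕ => ρ ^ (J - 1) * (‖Fp c‖ + 1)) atTop (𝓝 0) := by
      have := ((tendsto_pow_atTop_nhds_zero_of_lt_one hρ0.le hρ1).comp
        (tendsto_sub_atTop_nat 1)).mul_const (‖Fp c‖ + 1)
      simpa using this
    filter_upwards [hgeo.eventually_lt_const hδ] with J hJ z hz
    obtain ⟨h1, h2, -⟩ := hball z hz
    rw [dist_eq_norm, sub_sub_cancel, norm_mul, norm_pow]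
    refine lt_of_le_of_lt ?_ hJ
    gcongr
  · exact fun z hz hzc => (hball z hz).2.2.1 hF hzc

theorem exists_selectedRoot_and_order {ω C : ℝ} {Nα Nβ : ℕ} {α β : ℕ → ℝ} (hω : ω ≠ 0)
    (hC : |C| ≤ 1) (ha : aNeg ω C ≠ 0) (hb : aPos ω C ≠ 0)
    (hα : ∀ j, Nα ≤ j → α j = 0) (hβ : ∀ j, Nβ ≤ j → β j = 0) {c : ℂ} (hc : c ≠ 0)
    (hspec : c ∉ asymptoticSpectrum (toeplitzMatrix ω C)) :
    ∃ ε₀ : ℝ, 0 < ε₀ ∧ ∀ ε : ℝ, 0 < ε → ε < ε₀ →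
      (∃ κ : ℂ → ℂ, IsSelectedRoot ω C c ε κ) ∧
      ∀ κ : ℂ → ℂ, IsSelectedRoot ω C c ε κ →
        (|C| = 1 → ¬ ∀ᶠ z in 𝓝 c, boundaryFunction Nα Nβ α β κ z = 0) →
        ∀ᶠ J in atTop,
          HasZeroOfOrder (boundaryFunction Nα Nβ α β κ) c
            (eigenvalueCount (schemeMatrix ω C α β J) c ε) ∧
          ∀ κm κp : ℂ → ℂ, AreTheTwoRootsNear ω C c κm κp → κm =ᶠ[𝓝 c] κ →
            boundaryFunction Nα Nβ α β κp c ≠ 0 →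
            HasPoleOfOrder (reflectionCoefficient Nα Nβ α β κm κp) c
              (eigenvalueCount (schemeMatrix ω C α β J) c ε) := by
  have ha' : (aNeg ω C : ℂ) ≠ 0 := by exact_mod_cast ha
  obtain ⟨κ₁, κ₂, h₁, h₂, hpair, hlt⟩ := exists_isRootPair ha hb hc hspec
  obtain ⟨ε₀, hε₀, hball, hcount⟩ :=
    exists_radius_of_isRootPair hb hα hβ hc h₁ h₂ hpair hlt
  refine ⟨ε₀, hε₀, fun ε hε hεr => ?_⟩
  have hsub : closedBall c ε ⊆ ball c ε₀ := closedBall_subset_ball hεr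
  have hc₁ : ContinuousOn κ₁ (closedBall c ε) := fun z hz =>
    (hball z (hsub hz)).1.continuousAt.continuousWithinAt
  have hc₂ : ContinuousOn κ₂ (closedBall c ε) := fun z hz =>
    (hball z (hsub hz)).2.1.continuousAt.continuousWithinAt
  have hratio : ∀ z ∈ closedBall c ε,
      Tendsto (fun J : ℕ => chebyshevRatio ω C z J) atTop (𝓝 (κ₁ z / (aNeg ω C : ℂ))) :=
    fun z hz => tendsto_chebyshevRatio ha hb (hpair z) (hball z (hsub hz)).2.2
  refine ⟨⟨κ₁, hc₁, fun z _ => ?_, ?_⟩, fun κ hκ hF => ?_⟩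
  · obtain ⟨hs, hp⟩ := hpair z
    rw [BulkCharEq, ← hs, ← hp]
    ring
  · obtain ⟨w, hw⟩ : (sphere c ε).Nonempty := NormedSpace.sphere_nonempty.2 hε.le
    exact ⟨w, hw, hratio w (sphere_subset_closedBall hw)⟩
  · obtain ⟨hκc, hκe, w, hw, hκw⟩ := hκ
    have hw' := sphere_subset_closedBall hw
    -- The limit of the Chebyshev ratio selects the root of smaller modulus.
    have hww : κ w = κ₁ w :=
      (div_left_inj' ha').1 (tendsto_nhds_unique hκw (hratio w hw'))
    have heq := eqOn_of_bulkCharEq hb hκc hκe hc₁ hc₂ (fun z _ => hpair z)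
      (fun z hz h => (hball z (hsub hz)).2.2.ne (by rw [h])) hw' hww
    have hκ₁ : κ =ᶠ[𝓝 c] κ₁ := by
      filter_upwards [closedBall_mem_nhds c hε] with z hz using heq hz
    have hFeq : boundaryFunction Nα Nβ α β κ =ᶠ[𝓝 c] boundaryFunction Nα Nβ α β κ₁ := by
      filter_upwards [hκ₁] with z hz using boundaryFunction_congr _ _ _ _ hz
    have hF₁ : ¬ ∀ᶠ z in 𝓝 c, boundaryFunction Nα Nβ α β κ₁ z = 0 := by
      rcases hC.lt_or_eq with hC1 | hC1
      · refine not_eventually_boundaryFunction_eq_zero hω hC1 ha hb hα hβ hc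
          (κp := κ₂) (Eventually.of_forall hpair) ?_
        filter_upwards [ball_mem_nhds c hε₀] with z hz h
        exact (hball z hz).2.2.ne (by rw [h])
      · intro h
        refine hF hC1 ?_
        filter_upwards [h, hFeq] with z hz hz' using hz'.trans hz
    filter_upwards [hcount hF₁ ε hε hεr] with J hJ
    have hJ' : HasZeroOfOrder (boundaryFunction Nα Nβ α β κ) c
        (eigenvalueCount (schemeMatrix ω C α β J) c ε) :=
      ⟨hJ.1.congr hFeq.symm, by rw [analyticOrderAt_congr hFeq, hJ.2]⟩
    exact ⟨hJ', fun κm κp hmp hκm h0 =>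
      hasPoleOfOrder_reflectionCoefficient hc hb (h₁.congr hκ₁.symm) hJ' hmp hκm h0⟩

end TwoVelocityScheme

theorem mainTheorem1 (ω C : ℝ) (hstab : TwoVelocityScheme.PeriodicStabilityConditions ω C)
    (Nα Nβ : ℕ) (α β : ℕ → ℝ) (hα : ∀ j, Nα ≤ j → α j = 0) (hβ : ∀ j, Nβ ≤ j → β j = 0)
    (c : ℂ) (hc : TwoVelocityScheme.IsIsolatedOutflowPoint ω C α β c) :
    ∃ ε₀ : ℝ, 0 < ε₀ ∧ ∀ ε : ℝ, 0 < ε → ε < ε₀ →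
      -- the case `a_{-1} = 0`
      (TwoVelocityScheme.aNeg ω C = 0 →
        ∀ᶠ J in atTop,
          TwoVelocityScheme.HasZeroOfOrder
            (fun z : ℂ => (z ^ 2 - (α 0 : ℂ) * z - (β 0 : ℂ)) /
              (z ^ 2 - ((ω - 1 : ℝ) : ℂ))) c
            (TwoVelocityScheme.eigenvalueCount
              (TwoVelocityScheme.schemeMatrix ω C α β J) c ε)) ∧
      -- the case `a_{-1} ≠ 0`, `a_1 = 0`
      (TwoVelocityScheme.aNeg ω C ≠ 0 → TwoVelocityScheme.aPos ω C = 0 →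
        ∀ᶠ J in atTop,
          TwoVelocityScheme.HasZeroOfOrder
            (TwoVelocityScheme.boundaryFunction Nα Nβ α β
              (fun z => (TwoVelocityScheme.aNeg ω C : ℂ) * (TwoVelocityScheme.eta ω z)⁻¹)) c
            (TwoVelocityScheme.eigenvalueCount
              (TwoVelocityScheme.schemeMatrix ω C α β J) c ε)) ∧
      -- the case `a_{-1} ≠ 0`, `a_1 ≠ 0`
      (TwoVelocityScheme.aNeg ω C ≠ 0 → TwoVelocityScheme.aPos ω C ≠ 0 →
        (∃ κ : ℂ → ℂ, TwoVelocityScheme.IsSelectedRoot ω C c ε κ) ∧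
        ∀ κ : ℂ → ℂ, TwoVelocityScheme.IsSelectedRoot ω C c ε κ →
          -- for `|C| = 1` the boundary function may vanish identically, and then has no order
          (|C| = 1 → ¬ ∀ᶠ z in 𝓝 c, TwoVelocityScheme.boundaryFunction Nα Nβ α β κ z = 0) →
          ∀ᶠ J in atTop,
            TwoVelocityScheme.HasZeroOfOrder
              (TwoVelocityScheme.boundaryFunction Nα Nβ α β κ) c
              (TwoVelocityScheme.eigenvalueCount
                (TwoVelocityScheme.schemeMatrix ω C α β J) c ε) ∧
            ∀ κm κp : ℂ → ℂ, TwoVelocityScheme.AreTheTwoRootsNear ω C c κm κp →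
              κm =ᶠ[𝓝 c] κ →
              TwoVelocityScheme.boundaryFunction Nα Nβ α β κp c ≠ 0 →
              TwoVelocityScheme.HasPoleOfOrder
                (TwoVelocityScheme.reflectionCoefficient Nα Nβ α β κm κp) c
                (TwoVelocityScheme.eigenvalueCount
                  (TwoVelocityScheme.schemeMatrix ω C α β J) c ε)) := by
  obtain ⟨hc0, hspec, -⟩ := hc
  have hω : ω ≠ 0 := by
    rcases hstab with ⟨h, -, -⟩ | ⟨h, -⟩
    · exact h.ne'
    · rw [h]; norm_num
  have hC : |C| ≤ 1 := by
    rcases hstab with ⟨-, -, h⟩ | ⟨-, h⟩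
    · exact h
    · exact h.le
  by_cases ha : TwoVelocityScheme.aNeg ω C = 0
  · obtain ⟨ε₀, hε₀, h⟩ := TwoVelocityScheme.exists_hasZeroOfOrder_of_aNeg_eq_zero (α := α) (β := β)
      hc0 (TwoVelocityScheme.eta_ne_zero_of_notMem (by simp [ha]) hc0 hspec) ha
    exact ⟨ε₀, hε₀, fun ε hε hε' => ⟨fun _ => h ε hε hε', fun h' => absurd ha h',
      fun h' => absurd ha h'⟩⟩
  by_cases hb : TwoVelocityScheme.aPos ω C = 0
  · obtain ⟨ε₀, hε₀, h⟩ := TwoVelocityScheme.exists_hasZeroOfOrder_of_aPos_eq_zero hα hβ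
      hc0 (TwoVelocityScheme.eta_ne_zero_of_notMem (by simp [hb]) hc0 hspec) hb
    exact ⟨ε₀, hε₀, fun ε hε hε' => ⟨fun h' => absurd h' ha, fun _ _ => h ε hε hε',
      fun _ h' => absurd hb h'⟩⟩
  · obtain ⟨ε₀, hε₀, h⟩ :=
      TwoVelocityScheme.exists_selectedRoot_and_order hω hC ha hb hα hβ hc0 hspec
    exact ⟨ε₀, hε₀, fun ε hε hε' => ⟨fun h' => absurd h' ha, fun _ h' => absurd h' hb,
      fun _ _ => h ε hε hε'⟩⟩
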